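/- Let $G$ be a nontrivial finite group, let $\lambda\colon G\to\mathcal{U}(\ell^2(G))$ be its left regular representation, let $D=\bigotimes_{n=1}^{\infty}\mathcal{B}(\ell^2(G)^{\otimes n}\oplus\mathbb{C})$ (infinite C*-algebraic tensor product), and let $\alpha\colon G\to\mathrm{Aut}(D)$ be the action $\alpha_g=\bigotimes_{n=1}^{\infty}\mathrm{Ad}(\lambda_g^{\otimes n}\oplus 1)$ for $g\in G$. Then $\dim_{\mathrm{Rok}}(\alpha)=1$. Here the Rokhlin dimension is defined as follows. Let $\omega$ be a free ultrafilter on $\mathbb{N}$. For a unital C*-algebra $A$ let $A_\omega=\ell^\infty(\mathbb{N},A)/\{(a_n)_n:\lim_{n\to\omega}\|a_n\|=0\}$ be its ultrapower, regard $A$ as the subalgebra of (classes of) constant sequences in $A_\omega$, and let $\alpha_\omega$ be the action on $A_\omega$ obtained by applying an action $\alpha\colon G\to\mathrm{Aut}(A)$ pointwise. Then $\dim_{\mathrm{Rok}}(\alpha)\le d$ means that for every normal subgroup $H\le G$ of finite index there are positive contractions $f^{(j)}_{\bar g}\in A_\omega\cap A'$, for $j=0,\dots,d$ and $\bar g\in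 G/H$, such that (a) $(\alpha_\omega)_g(f^{(j)}_{\bar h})=f^{(j)}_{\overline{gh}}$ for all $j$, all $g\in G$ and all $\bar h\in G/H$; (b) $f^{(j)}_{\bar g}f^{(j)}_{\bar h}=0$ for all $j$ and all $\bar g\ne\bar h$ in $G/H$; (c) $\sum_{j=0}^{d}\sum_{\bar g\in G/H}f^{(j)}_{\bar g}=1$. The number $\dim_{\mathrm{Rok}}(\alpha)$ is the smallest integer $d\ge 0$ with $\dim_{\mathrm{Rok}}(\alpha)\le d$ (and $\infty$ if there is none). The claim holds for every free ultrafilter $\omega$. -/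

import Mathlib

open Filter Topology
open scoped BoundedContinuousFunction ENNReal

noncomputable section

/-! ### Norm ultrapowers of C*-algebras

Bounded sequences in `A` are modelled by Mathlib's `ℕ →ᵇ A` (every function on the discrete space
`ℕ` is continuous), with pointwise operations and the supremum norm. -/

/-- `c_ω(A)`: the two-sided ideal of the bounded sequences whose norms tend to `0` along `ω`. -/
def nullIdeal (ω : Ultrafilter ℕ) (A : Type*) [CStarAlgebra A] : Ideal (ℕ →ᵇ A) where
  carrier := {a | Tendsto (fun n => ‖a n‖) ω (𝓝 0)}
  zero_mem' := by simp
  add_mem' := by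
    intro a b ha hb
    refine squeeze_zero (fun n => norm_nonneg _) (fun n => norm_add_le (a n) (b n)) ?_
    simpa using Tendsto.add ha hb
  smul_mem' := by
    intro c a ha
    refine squeeze_zero (fun n => norm_nonneg _) (fun n => ?_)
      (by simpa using Tendsto.const_mul ‖c‖ ha : Tendsto (fun n => ‖c‖ * ‖a n‖) ω (𝓝 0))
    calc ‖c n * a n‖ ≤ ‖c n‖ * ‖a n‖ := norm_mul_le _ _
      _ ≤ ‖c‖ * ‖a n‖ := by gcongr; exact c.norm_coe_le_norm n

theorem mem_nullIdeal {ω : Ultrafilter ℕ} {A : Type*} [CStarAlgebra A] {a : ℕ →ᵇ A} :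
    a ∈ nullIdeal ω A ↔ Tendsto (fun n => ‖a n‖) ω (𝓝 0) := Iff.rfl

instance nullIdeal_isTwoSided (ω : Ultrafilter ℕ) (A : Type*) [CStarAlgebra A] :
    (nullIdeal ω A).IsTwoSided where
  mul_mem_of_left := by
    intro a b ha
    rw [mem_nullIdeal] at ha ⊢
    refine squeeze_zero (fun n => norm_nonneg _) (fun n => ?_)
      (by simpa using Tendsto.mul_const ‖b‖ ha : Tendsto (fun n => ‖a n‖ * ‖b‖) ω (𝓝 0))
    calc ‖a n * b n‖ ≤ ‖a n‖ * ‖b n‖ := norm_mul_le _ _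
      _ ≤ ‖a n‖ * ‖b‖ := by gcongr; exact b.norm_coe_le_norm n

/-- The ultrapower `A_ω = ℓ^∞(ℕ, A) / c_ω(A)`, with the quotient ring structure and the
quotient norm. -/
abbrev Ultrapower (ω : Ultrafilter ℕ) (A : Type*) [CStarAlgebra A] : Type _ :=
  (ℕ →ᵇ A) ⧸ nullIdeal ω A

namespace Ultrapower

variable (ω : Ultrafilter ℕ) {A : Type*} [CStarAlgebra A]

theorem star_mem_nullIdeal {a : ℕ →ᵇ A} (ha : a ∈ nullIdeal ω A) : star a ∈ nullIdeal ω A := by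
  rw [mem_nullIdeal] at ha ⊢
  simpa using ha

/-- The involution of `A_ω`, induced by the pointwise involution of sequences. -/
instance : StarRing (Ultrapower ω A) where
  star := Quotient.map' star (by
    intro a b h
    rw [Submodule.quotientRel_def] at h ⊢
    rw [← star_sub]
    exact star_mem_nullIdeal ω h)
  star_involutive := by
    rintro ⟨a⟩
    exact congrArg (Ideal.Quotient.mk (nullIdeal ω A)) (star_star a)
  star_mul := by
    rintro ⟨a⟩ ⟨b⟩
    exact congrArg (Ideal.Quotient.mk (nullIdeal ω A)) (star_mul a b)
  star_add := by
    rintro ⟨a⟩ ⟨b⟩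
    exact congrArg (Ideal.Quotient.mk (nullIdeal ω A)) (star_add a b)

/-- The embedding of `A` into `A_ω` by constant sequences. -/
def const (a : A) : Ultrapower ω A :=
  Ideal.Quotient.mk (nullIdeal ω A) (BoundedContinuousFunction.const ℕ a)

/-- An automorphism of `A` applied pointwise to bounded sequences. -/
def seqMap (φ : A ≃⋆ₐ[ℂ] A) : (ℕ →ᵇ A) →+* (ℕ →ᵇ A) where
  toFun a := BoundedContinuousFunction.ofNormedAddCommGroupDiscrete (fun n => φ (a n)) ‖a‖
    (fun n => (NonUnitalStarAlgHom.norm_apply_le φ (a n)).trans (a.norm_coe_le_norm n))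
  map_one' := by ext n; exact map_one φ
  map_mul' a b := by ext n; exact map_mul φ (a n) (b n)
  map_zero' := by ext n; exact map_zero φ
  map_add' a b := by ext n; exact map_add φ (a n) (b n)

/-- The map `φ_ω` induced on `A_ω` by an automorphism `φ` of `A`. -/
def map (φ : A ≃⋆ₐ[ℂ] A) : Ultrapower ω A →+* Ultrapower ω A :=
  Ideal.quotientMap (nullIdeal ω A) (seqMap φ) (by
    intro a ha
    rw [Ideal.mem_comap, mem_nullIdeal]
    rw [mem_nullIdeal] at ha
    exact squeeze_zero (fun n => norm_nonneg _)
      (fun n => NonUnitalStarAlgHom.norm_apply_le φ (a n)) ha)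

/-- Positive contractions of `A_ω`: elements of the form `x* x` of norm at most one. -/
def IsPositiveContraction (f : Ultrapower ω A) : Prop :=
  (∃ x : Ultrapower ω A, f = star x * x) ∧ ‖f‖ ≤ 1

end Ultrapower

/-! ### Rokhlin dimension -/

/-- `dimRok(α) ≤ d`, computed in the ultrapower along `ω`. -/
def DimRokLE (ω : Ultrafilter ℕ) {G A : Type*} [Group G] [CStarAlgebra A]
    (α : G →* (A ≃⋆ₐ[ℂ] A)) (d : ℕ) : Prop :=
  ∀ H : Subgroup G, H.Normal → H.FiniteIndex →
    ∃ f : Fin (d + 1) → G ⧸ H → Ultrapower ω A,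
      (∀ j q, Ultrapower.IsPositiveContraction ω (f j q)) ∧
      (∀ j q (a : A), Ultrapower.const ω a * f j q = f j q * Ultrapower.const ω a) ∧
      (∀ j (g : G) (q : G ⧸ H), Ultrapower.map ω (α g) (f j q) = f j (g • q)) ∧
      (∀ j (p q : G ⧸ H), p ≠ q → f j p * f j q = 0) ∧
      ∑ j, ∑ᶠ q : G ⧸ H, f j q = 1

/-- The Rokhlin dimension: the least `d` with `dimRok(α) ≤ d`, and `⊤` if there is none. -/
def dimRok (ω : Ultrafilter ℕ) {G A : Type*} [Group G] [CStarAlgebra A]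
    (α : G →* (A ≃⋆ₐ[ℂ] A)) : ℕ∞ :=
  ⨅ (d : ℕ) (_ : DimRokLE ω α d), (d : ℕ∞)

/-! ### Infinite tensor products of full matrix algebras

Let `I n` be finite index sets with base points `b n`, and identify `B(ℓ²(I n))` with the matrices
over `I n`. The infinite tensor product of the `B(ℓ²(I n))` is realized spatially, on the infinite
tensor product of the Hilbert spaces `ℓ²(I n)` along the unit vectors `δ_{b n}`. The latter has as
orthonormal basis the elementary tensors `⊗ δ_{x n}` with `x n = b n` for all but finitely many
`n`. -/

section InfiniteTensor

variable {I : ℕ → Type*} (b : ∀ n, I n)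

/-- Sequences in `∏ I n` that differ from the base point in only finitely many coordinates. -/
abbrev RestrictedProd : Type _ := {x : ∀ n, I n // {n | x n ≠ b n}.Finite}

/-- The infinite tensor product of the Hilbert spaces `ℓ²(I n)` along the vectors `δ_{b n}`. -/
abbrev TensorHilbert : Type _ := lp (fun _ : RestrictedProd b => ℂ) 2

namespace RestrictedProd

variable {b}

/-- Replace the `n`-th coordinate by `i`. -/
def update (x : RestrictedProd b) (n : ℕ) (i : I n) : RestrictedProd b :=
  ⟨Function.update x.1 n i, by
    refine (x.2.union (Set.finite_singleton n)).subset fun m hm => ?_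
    by_cases h : m = n
    · exact Or.inr h
    · left
      simpa [Function.update_of_ne h] using hm⟩

@[simp] theorem update_self (x : RestrictedProd b) (n : ℕ) (i : I n) :
    (x.update n i).1 n = i := by simp [update]

@[simp] theorem update_update (x : RestrictedProd b) (n : ℕ) (i j : I n) :
    (x.update n i).update n j = x.update n j := by
  apply Subtype.ext; simp [update]

theorem update_eq_self (x : RestrictedProd b) (n : ℕ) : x.update n (x.1 n) = x := by
  apply Subtype.ext; simp [update]

variable [∀ n, DecidableEq (I n)]

/-- The permutation that swaps the values `i` and `j` in the `n`-th coordinate. -/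
def swapAt (n : ℕ) (i j : I n) : Equiv.Perm (RestrictedProd b) :=
  Function.Involutive.toPerm (fun x => x.update n (Equiv.swap i j (x.1 n))) (by
    intro x
    simp [update_eq_self])

theorem swapAt_apply (n : ℕ) (i j : I n) (x : RestrictedProd b) :
    swapAt n i j x = x.update n (Equiv.swap i j (x.1 n)) := rfl

end RestrictedProd

variable {b}

theorem summable_sq (ξ : TensorHilbert b) : Summable fun x => ‖ξ x‖ ^ (2 : ℝ≥0∞).toReal :=
  (memℓp_gen_iff (by simp)).1 (lp.memℓp ξ)

theorem tendsto_coord {u : ℕ → TensorHilbert b} {ξ : TensorHilbert b}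
    (h : Tendsto u atTop (𝓝 ξ)) (x : RestrictedProd b) :
    Tendsto (fun k => u k x) atTop (𝓝 (ξ x)) := by
  rw [tendsto_iff_norm_sub_tendsto_zero] at h ⊢
  exact squeeze_zero (fun k => norm_nonneg _)
    (fun k => lp.norm_apply_le_norm (by simp) (u k - ξ) x) h

theorem sum_coord {ι : Type*} (s : Finset ι) (f : ι → TensorHilbert b) (x : RestrictedProd b) :
    (∑ k ∈ s, f k) x = ∑ k ∈ s, f k x := by
  rw [lp.coeFn_sum]
  exact Finset.sum_apply x s fun k => (f k : RestrictedProd b → ℂ)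

variable [∀ n, DecidableEq (I n)]

theorem memℓp_leg (n : ℕ) (i j : I n) (ξ : TensorHilbert b) :
    Memℓp (fun x : RestrictedProd b => if x.1 n = i then ξ (x.update n j) else 0) 2 := by
  refine memℓp_gen (Summable.of_nonneg_of_le (fun x => by positivity) (fun x => ?_)
    ((RestrictedProd.swapAt n i j).summable_iff.2 (summable_sq ξ)))
  by_cases h : x.1 n = i
  · simp [h, RestrictedProd.swapAt_apply]
  · simp [h]

/-- The matrix unit `e_{ij}` acting on the `n`-th tensor factor: it maps the basis vector `δ_y` to
`δ_{y'}`, where `y'` is `y` with `n`-th coordinate `i`, if `y n = j`, and to `0` otherwise. -/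
def legUnit (n : ℕ) (i j : I n) : TensorHilbert b →L[ℂ] TensorHilbert b :=
  ContinuousLinearMap.ofSeqClosedGraph
    (g := { toFun := fun ξ => ⟨_, memℓp_leg n i j ξ⟩
            map_add' := fun ξ η => by
              ext x
              change (if x.1 n = i then ξ (x.update n j) + η (x.update n j) else 0) =
                (if x.1 n = i then ξ (x.update n j) else 0) +
                  (if x.1 n = i then η (x.update n j) else 0)
              by_cases h : x.1 n = i <;> simp [h]
            map_smul' := fun c ξ => by
              ext x
              by_cases h : x.1 n = i <;> simp [h] })
    (by
      intro u ξ η hu hT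
      ext x
      refine tendsto_nhds_unique (tendsto_coord hT x) ?_
      by_cases h : x.1 n = i
      · simpa [h] using tendsto_coord hu (x.update n j)
      · simp [h])

theorem legUnit_apply (n : ℕ) (i j : I n) (ξ : TensorHilbert b) (x : RestrictedProd b) :
    legUnit n i j ξ x = if x.1 n = i then ξ (x.update n j) else 0 := rfl

theorem legUnit_mul (n : ℕ) (i j k l : I n) :
    (legUnit n i j : TensorHilbert b →L[ℂ] TensorHilbert b) * legUnit n k l =
      if j = k then legUnit n i l else 0 := by
  ext ξ x
  by_cases hj : j = k <;> by_cases h : x.1 n = i <;>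
    simp [legUnit_apply, hj, h]

theorem star_legUnit (n : ℕ) (i j : I n) :
    star (legUnit n i j : TensorHilbert b →L[ℂ] TensorHilbert b) = legUnit n j i := by
  rw [ContinuousLinearMap.star_eq_adjoint, eq_comm, ContinuousLinearMap.eq_adjoint_iff]
  intro ξ η
  rw [lp.inner_eq_tsum, lp.inner_eq_tsum, ← (RestrictedProd.swapAt n i j).tsum_eq]
  refine tsum_congr fun x => ?_
  rw [legUnit_apply, legUnit_apply, RestrictedProd.swapAt_apply]
  by_cases h : x.1 n = i
  · have h' : x.update n i = x := by rw [← h, RestrictedProd.update_eq_self]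
    simp [h, h']
  · have : Equiv.swap i j (x.1 n) ≠ j := by
      intro h'
      apply h
      have := congrArg (Equiv.swap i j) h'
      simpa using this
    simp [h, this]

variable [∀ n, Fintype (I n)]

/-- The operator `1 ⊗ ⋯ ⊗ 1 ⊗ M ⊗ 1 ⊗ ⋯` with `M` in position `n`. -/
def legFun (b : ∀ n, I n) (n : ℕ) (M : Matrix (I n) (I n) ℂ) :
    TensorHilbert b →L[ℂ] TensorHilbert b :=
  ∑ i, ∑ j, M i j • legUnit n i j

theorem legFun_apply (n : ℕ) (M : Matrix (I n) (I n) ℂ) (ξ : TensorHilbert b)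
    (x : RestrictedProd b) : legFun b n M ξ x = ∑ j, M (x.1 n) j * ξ (x.update n j) := by
  have h : ∀ i j, (M i j • legUnit n i j : TensorHilbert b →L[ℂ] TensorHilbert b) ξ x =
      if x.1 n = i then M i j * ξ (x.update n j) else 0 := by
    intro i j
    change M i j * (legUnit n i j ξ x) = _
    rw [legUnit_apply, mul_ite, mul_zero]
  simp only [legFun, sum_apply, sum_coord, h]
  rw [Finset.sum_comm]
  simp

/-- The embedding `B(ℓ²(I n)) → B(H)`, `M ↦ 1 ⊗ ⋯ ⊗ 1 ⊗ M ⊗ 1 ⊗ ⋯` with `M` in position `n`. -/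
def leg (b : ∀ n, I n) (n : ℕ) :
    Matrix (I n) (I n) ℂ →⋆ₐ[ℂ] (TensorHilbert b →L[ℂ] TensorHilbert b) where
  toFun := legFun b n
  map_one' := by
    ext ξ x
    rw [legFun_apply]
    simp [Matrix.one_apply, RestrictedProd.update_eq_self]
  map_mul' M N := by
    ext ξ x
    rw [legFun_apply, mul_apply_eq_comp, legFun_apply]
    simp only [legFun_apply, RestrictedProd.update_self, RestrictedProd.update_update,
      Matrix.mul_apply, Finset.sum_mul, Finset.mul_sum, mul_assoc]
    exact Finset.sum_comm
  map_zero' := by simp [legFun]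
  map_add' M N := by simp [legFun, add_smul, Finset.sum_add_distrib]
  commutes' c := by
    ext ξ x
    rw [legFun_apply]
    simp [Matrix.algebraMap_matrix_apply, RestrictedProd.update_eq_self,
      ContinuousLinearMap.algebraMap_apply]
  map_star' M := by
    simp only [legFun, star_sum, star_smul, star_legUnit]
    rw [Finset.sum_comm]
    rfl

theorem leg_apply (n : ℕ) (M : Matrix (I n) (I n) ℂ) (ξ : TensorHilbert b)
    (x : RestrictedProd b) : leg b n M ξ x = ∑ j, M (x.1 n) j * ξ (x.update n j) :=
  legFun_apply n M ξ x

/-- The infinite tensor product C*-algebra `⊗ B(ℓ²(I n))`: the norm closure of the *-algebra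
generated by the tensor factors. -/
def tensorAlgebra (b : ∀ n, I n) :
    StarSubalgebra ℂ (TensorHilbert b →L[ℂ] TensorHilbert b) :=
  (StarAlgebra.adjoin ℂ (⋃ n, Set.range (leg b n))).topologicalClosure

instance tensorAlgebra_isClosed (b : ∀ n, I n) :
    IsClosed (tensorAlgebra b : Set (TensorHilbert b →L[ℂ] TensorHilbert b)) :=
  StarSubalgebra.isClosed_topologicalClosure _

theorem leg_mem (n : ℕ) (M : Matrix (I n) (I n) ℂ) : leg b n M ∈ tensorAlgebra b :=
  StarSubalgebra.le_topologicalClosure _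
    (StarAlgebra.subset_adjoin ℂ _ (Set.mem_iUnion.2 ⟨n, M, rfl⟩))

/-- A *-automorphism of `B(H)` that maps every tensor factor into itself maps `⊗ B(ℓ²(I n))` into
itself. -/
theorem map_mem_tensorAlgebra
    (φ : (TensorHilbert b →L[ℂ] TensorHilbert b) ≃⋆ₐ[ℂ] (TensorHilbert b →L[ℂ] TensorHilbert b))
    (hφ : ∀ n M, ∃ N, φ (leg b n M) = leg b n N)
    {T : TensorHilbert b →L[ℂ] TensorHilbert b} (hT : T ∈ tensorAlgebra b) :
    φ T ∈ tensorAlgebra b := by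
  let ψ : (TensorHilbert b →L[ℂ] TensorHilbert b) →⋆ₐ[ℂ] (TensorHilbert b →L[ℂ] TensorHilbert b) :=
    φ
  have hc : Continuous ψ := AddMonoidHomClass.continuous_of_bound ψ 1 fun T => by
    simpa using NonUnitalStarAlgHom.norm_apply_le ψ T
  have h : tensorAlgebra b ≤ (tensorAlgebra b).comap ψ := by
    refine StarSubalgebra.topologicalClosure_minimal ?_ ((tensorAlgebra_isClosed b).preimage hc)
    refine StarAlgebra.adjoin_le (Set.iUnion_subset fun n => ?_)
    rintro _ ⟨M, rfl⟩
    obtain ⟨N, hN⟩ := hφ n M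
    change φ (leg b n M) ∈ tensorAlgebra b
    rw [hN]
    exact leg_mem n N
  exact h hT

end InfiniteTensor

/-! ### The product-type action -/

section ProductAction

variable (G : Type*) [Group G]

/-- The basis of `ℓ²(G)^{⊗(k+1)} ⊕ ℂ`: the elementary tensors of the basis vectors of `ℓ²(G)`,
and the unit vector of `ℂ`. -/
abbrev FactorIndex (k : ℕ) : Type _ := (Fin (k + 1) → G) ⊕ Unit

/-- The reference vectors: the unit vector of `ℂ` in each `ℓ²(G)^{⊗(k+1)} ⊕ ℂ`. -/
def factorBase (k : ℕ) : FactorIndex G k := Sum.inr ()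

variable {G}

/-- The matrix of the left regular representation, `λ_g δ_h = δ_{gh}`. -/
def leftRegular [DecidableEq G] (g : G) : Matrix G G ℂ :=
  Matrix.of fun h k => if h = g * k then 1 else 0

/-- The tensor power `M^{⊗m}`, with `ℓ²(X)^{⊗m}` identified with `ℓ²(X^m)`. -/
def tensorPow {X : Type*} (m : ℕ) (M : Matrix X X ℂ) : Matrix (Fin m → X) (Fin m → X) ℂ :=
  Matrix.of fun x y => ∏ i, M (x i) (y i)

/-- The matrix of `λ_g^{⊗(k+1)} ⊕ 1`. -/
def factorUnitary [DecidableEq G] (k : ℕ) (g : G) :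
    Matrix (FactorIndex G k) (FactorIndex G k) ℂ :=
  Matrix.fromBlocks (tensorPow (k + 1) (leftRegular g)) 0 0 1

/-- Left translation on the basis of `ℓ²(G)^{⊗(k+1)} ⊕ ℂ`, as a permutation: `g` multiplies all
entries of a tuple from the left and fixes the extra point. -/
def factorShift (k : ℕ) (g : G) : Equiv.Perm (FactorIndex G k) :=
  Equiv.sumCongr (Equiv.piCongrRight fun _ => Equiv.mulLeft g) (Equiv.refl Unit)

theorem factorShift_one (k : ℕ) (i : FactorIndex G k) : factorShift k (1 : G) i = i := by
  rcases i with y | y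
  · exact congrArg Sum.inl (funext fun m => one_mul (y m))
  · rfl

theorem factorShift_mul (k : ℕ) (g h : G) (i : FactorIndex G k) :
    factorShift k (g * h) i = factorShift k g (factorShift k h i) := by
  rcases i with y | y
  · exact congrArg Sum.inl (funext fun m => mul_assoc g h (y m))
  · rfl

theorem factorShift_symm (k : ℕ) (g : G) (i : FactorIndex G k) :
    (factorShift k g).symm i = factorShift k g⁻¹ i := by
  rw [Equiv.symm_apply_eq, ← factorShift_mul, mul_inv_cancel, factorShift_one]

/-- Left translation on the basis of the infinite tensor product, in all coordinates at once. -/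
def leftShift (g : G) (x : RestrictedProd (factorBase G)) : RestrictedProd (factorBase G) :=
  ⟨fun k => factorShift k g (x.1 k), by
    refine x.2.subset fun k hk h => hk ?_
    change factorShift k g (x.1 k) = factorBase G k
    rw [h]
    rfl⟩

theorem leftShift_one (x : RestrictedProd (factorBase G)) : leftShift 1 x = x :=
  Subtype.ext (funext fun k => factorShift_one k (x.1 k))

theorem leftShift_mul (g h : G) (x : RestrictedProd (factorBase G)) :
    leftShift (g * h) x = leftShift g (leftShift h x) :=
  Subtype.ext (funext fun k => factorShift_mul k g h (x.1 k))

theorem leftShift_update (g : G) (x : RestrictedProd (factorBase G)) (k : ℕ)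
    (i : FactorIndex G k) :
    leftShift g (x.update k i) = (leftShift g x).update k (factorShift k g i) := by
  apply Subtype.ext
  funext m
  by_cases h : m = k
  · subst h
    simp [leftShift, RestrictedProd.update]
  · simp [leftShift, RestrictedProd.update, h]

/-- Left translation by `g` as a permutation. -/
def leftShiftEquiv (g : G) : Equiv.Perm (RestrictedProd (factorBase G)) where
  toFun := leftShift g
  invFun := leftShift g⁻¹
  left_inv x := by rw [← leftShift_mul, inv_mul_cancel, leftShift_one]
  right_inv x := by rw [← leftShift_mul, mul_inv_cancel, leftShift_one]

/-- `ξ ↦ ξ(g⁻¹ ·)` as a linear map. -/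
def tensorUnitaryLin (g : G) : TensorHilbert (factorBase G) →ₗ[ℂ] TensorHilbert (factorBase G) where
  toFun ξ := ⟨fun x => ξ (leftShift g⁻¹ x),
    memℓp_gen ((leftShiftEquiv g⁻¹).summable_iff.2 (summable_sq ξ))⟩
  map_add' _ _ := rfl
  map_smul' _ _ := rfl

theorem tensorUnitaryLin_apply (g : G) (ξ : TensorHilbert (factorBase G))
    (x : RestrictedProd (factorBase G)) : tensorUnitaryLin g ξ x = ξ (leftShift g⁻¹ x) := rfl

/-- The unitary `⊗ (λ_g^{⊗n} ⊕ 1)` of the infinite tensor product Hilbert space: it maps `δ_y` to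
`δ_{gy}`. -/
def tensorUnitary (g : G) :
    TensorHilbert (factorBase G) ≃ₗᵢ[ℂ] TensorHilbert (factorBase G) where
  toLinearEquiv := LinearEquiv.ofLinearMap (tensorUnitaryLin g) (tensorUnitaryLin g⁻¹)
    (by
      ext ξ x
      simp [tensorUnitaryLin_apply, ← leftShift_mul, leftShift_one])
    (by
      ext ξ x
      simp [tensorUnitaryLin_apply, ← leftShift_mul, leftShift_one])
  norm_map' ξ := by
    have h2 : (0 : ℝ) < (2 : ℝ≥0∞).toReal := by simp
    change ‖tensorUnitaryLin g ξ‖ = ‖ξ‖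
    rw [lp.norm_eq_tsum_rpow h2, lp.norm_eq_tsum_rpow h2]
    congr 1
    exact (leftShiftEquiv g⁻¹).tsum_eq fun x => ‖ξ x‖ ^ (2 : ℝ≥0∞).toReal

theorem tensorUnitary_apply (g : G) (ξ : TensorHilbert (factorBase G))
    (x : RestrictedProd (factorBase G)) : tensorUnitary g ξ x = ξ (leftShift g⁻¹ x) := rfl

theorem tensorUnitary_symm_apply (g : G) (ξ : TensorHilbert (factorBase G))
    (x : RestrictedProd (factorBase G)) : (tensorUnitary g).symm ξ x = ξ (leftShift g x) := by
  change ξ (leftShift g⁻¹⁻¹ x) = _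
  rw [inv_inv]

theorem conjUnitary_one (T : TensorHilbert (factorBase G) →L[ℂ] TensorHilbert (factorBase G)) :
    (tensorUnitary (1 : G)).conjStarAlgEquiv T = T := by
  have h : ∀ ξ, (tensorUnitary (1 : G)).symm ξ = ξ := by
    intro ξ
    ext x
    rw [tensorUnitary_symm_apply, leftShift_one]
  ext ξ x
  rw [LinearIsometryEquiv.conjStarAlgEquiv_apply_apply, h, tensorUnitary_apply, inv_one,
    leftShift_one]

theorem conjUnitary_mul (g h : G) (T : TensorHilbert (factorBase G) →L[ℂ] TensorHilbert (factorBase G)) :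
    (tensorUnitary (g * h)).conjStarAlgEquiv T =
      (tensorUnitary g).conjStarAlgEquiv ((tensorUnitary h).conjStarAlgEquiv T) := by
  have e : ∀ ξ, (tensorUnitary (g * h)).symm ξ =
      (tensorUnitary h).symm ((tensorUnitary g).symm ξ) := by
    intro ξ
    ext x
    simp only [tensorUnitary_symm_apply, leftShift_mul]
  ext ξ x
  simp only [LinearIsometryEquiv.conjStarAlgEquiv_apply_apply, tensorUnitary_apply, e,
    mul_inv_rev, leftShift_mul]

theorem factorUnitary_apply [DecidableEq G] (k : ℕ) (g : G) (i j : FactorIndex G k) :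
    factorUnitary k g i j = if i = factorShift k g j then 1 else 0 := by
  rcases i with x | x <;> rcases j with y | y
  · simp [factorUnitary, tensorPow, leftRegular, Finset.prod_ite_zero, funext_iff, factorShift]
  · simp [factorUnitary, factorShift]
  · simp [factorUnitary, factorShift]
  · simp [factorUnitary, factorShift]

variable [Fintype G] [DecidableEq G]

theorem factorUnitary_conj_apply (k : ℕ) (g : G)
    (M : Matrix (FactorIndex G k) (FactorIndex G k) ℂ) (i j : FactorIndex G k) :
    (factorUnitary k g * M * star (factorUnitary k g)) i j =
      M (factorShift k g⁻¹ i) (factorShift k g⁻¹ j) := by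
  have h : ∀ i l : FactorIndex G k, i = factorShift k g l ↔ l = factorShift k g⁻¹ i := by
    intro i l
    rw [← factorShift_symm, Equiv.eq_symm_apply, eq_comm]
  simp [Matrix.mul_apply, Matrix.star_apply, factorUnitary_apply, h, apply_ite]

/-- Conjugation by `⊗ (λ_g^{⊗n} ⊕ 1)` restricts to `Ad(λ_g^{⊗n} ⊕ 1)` on each tensor factor. -/
theorem conj_leg (g : G) (k : ℕ) (M : Matrix (FactorIndex G k) (FactorIndex G k) ℂ) :
    (tensorUnitary g).conjStarAlgEquiv (leg (factorBase G) k M) =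
      leg (factorBase G) k (factorUnitary k g * M * star (factorUnitary k g)) := by
  ext ξ x
  rw [LinearIsometryEquiv.conjStarAlgEquiv_apply_apply, tensorUnitary_apply, leg_apply, leg_apply]
  conv_rhs => rw [← Equiv.sum_comp (factorShift k g)]
  refine Finset.sum_congr rfl fun j _ => ?_
  rw [tensorUnitary_symm_apply, leftShift_update, ← leftShift_mul, mul_inv_cancel, leftShift_one,
    factorUnitary_conj_apply, ← factorShift_mul, inv_mul_cancel, factorShift_one]
  rfl

/-- The C*-algebra `D = ⊗_{n ≥ 1} B(ℓ²(G)^{⊗n} ⊕ ℂ)`; the factor with index `k : ℕ` is the one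
with `n = k + 1`. -/
abbrev productAlgebra (G : Type*) [Group G] [Fintype G] [DecidableEq G] : Type _ :=
  tensorAlgebra (factorBase G)

theorem conjUnitary_mem (g : G) {T : TensorHilbert (factorBase G) →L[ℂ] TensorHilbert (factorBase G)}
    (hT : T ∈ tensorAlgebra (factorBase G)) :
    (tensorUnitary g).conjStarAlgEquiv T ∈ tensorAlgebra (factorBase G) :=
  map_mem_tensorAlgebra _ (fun k M => ⟨_, conj_leg g k M⟩) hT

/-- The automorphism `α_g = ⊗_{n ≥ 1} Ad(λ_g^{⊗n} ⊕ 1)` of `D`. -/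
def productAut (g : G) : productAlgebra G ≃⋆ₐ[ℂ] productAlgebra G where
  toFun T := ⟨(tensorUnitary g).conjStarAlgEquiv T.1, conjUnitary_mem g T.2⟩
  invFun T := ⟨(tensorUnitary g⁻¹).conjStarAlgEquiv T.1, conjUnitary_mem g⁻¹ T.2⟩
  left_inv T := Subtype.ext (by
    change (tensorUnitary g⁻¹).conjStarAlgEquiv ((tensorUnitary g).conjStarAlgEquiv T.1) = T.1
    rw [← conjUnitary_mul, inv_mul_cancel, conjUnitary_one])
  right_inv T := Subtype.ext (by
    change (tensorUnitary g).conjStarAlgEquiv ((tensorUnitary g⁻¹).conjStarAlgEquiv T.1) = T.1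
    rw [← conjUnitary_mul, mul_inv_cancel, conjUnitary_one])
  map_mul' S T := Subtype.ext (map_mul (tensorUnitary g).conjStarAlgEquiv S.1 T.1)
  map_add' S T := Subtype.ext (map_add (tensorUnitary g).conjStarAlgEquiv S.1 T.1)
  map_star' T := Subtype.ext (map_star (tensorUnitary g).conjStarAlgEquiv T.1)
  map_smul' c T := Subtype.ext (map_smul (tensorUnitary g).conjStarAlgEquiv c T.1)

/-- The product-type action `α : G → Aut(D)`. -/
def productAction (G : Type*) [Group G] [Fintype G] [DecidableEq G] :
    G →* (productAlgebra G ≃⋆ₐ[ℂ] productAlgebra G) where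
  toFun := productAut
  map_one' := by
    ext T : 1
    exact Subtype.ext (conjUnitary_one T.1)
  map_mul' g h := by
    ext T : 1
    exact Subtype.ext (conjUnitary_mul g h T.1)

/-- On the factor `B(ℓ²(G)^{⊗n} ⊕ ℂ)` the action is `Ad(λ^{⊗n} ⊕ 1)`. -/
theorem productAction_leg (g : G) (k : ℕ) (M : Matrix (FactorIndex G k) (FactorIndex G k) ℂ) :
    productAction G g ⟨leg (factorBase G) k M, leg_mem k M⟩ =
      ⟨leg (factorBase G) k (factorUnitary k g * M * star (factorUnitary k g)), leg_mem k _⟩ :=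
  Subtype.ext (conj_leg g k M)

end ProductAction

end

/-! Lower bound. In dimension zero the Rokhlin elements are orthogonal and sum to one, so they are
projections `p_h` permuted by `G`. Take `g ≠ 1`, a primitive root of unity `ζ` of order `orderOf g`,
and a unimodular `c` on `G` with `c (g * h) = ζ * c h`. Then `∑ star (c h) • p_h` is a unitary of
the ultrapower that the action of `g` multiplies by `ζ`. Lifting it as a twisted sum keeps the
eigenvector relation exact (`DimRokLE.exists_twistedSum`, `map_twistedSum`), and by density the lift
may be taken in the algebraic tensor product. This gives an operator `T` with `U_g T U_g* = ζ T` and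
`‖T* T - 1‖ < 1` that preserves a finite-dimensional space spanned by basis vectors. There `U_g`
permutes the basis, fixing the base point and moving all other points in orbits of length `orderOf
g`. Each such orbit contributes one dimension to the fixed space and one to the `ζ`-eigenspace, so
the fixed space is larger by one and `T` cannot map it injectively into the other
(`one_le_norm_star_mul_self_sub_one`).

Upper bound. The factor with index `n` is `B(ℓ²(G) ⊗ ℂ^k ⊕ ℂ)` with `k = |G|^n`, and only the extra
invariant vector prevents an exact Rokhlin tower. Two towers with complementary weights `i / k` and
`1 - i / k` are used. The second is conjugated by an equivariant partial isometry that moves the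
invariant vectors down by one index and the first of them onto the extra vector. As the weights vary
by `1 / k` per step, the sum of the towers misses the identity only by `1 / k` times a projection
(`sum_tower`). Letting `n` grow removes this error and makes the towers central
(`tendsto_norm_commutator_leg`). -/

noncomputable section

/-! ### Finite-dimensional subspaces of the infinite tensor product -/

section Support

variable {I : ℕ → Type*} (b : ∀ n, I n)

/-- The vectors supported on the sequences that agree with the base point from `K` on. -/
def supportedBelow (K : ℕ) : Submodule ℂ (TensorHilbert b) where
  carrier := {ξ | ∀ x : RestrictedProd b, (∃ n, K ≤ n ∧ x.1 n ≠ b n) → ξ x = 0}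
  zero_mem' := fun _ _ => rfl
  add_mem' := by
    intro ξ η hξ hη x hx
    change ξ x + η x = 0
    rw [hξ x hx, hη x hx, add_zero]
  smul_mem' := by
    intro c ξ hξ x hx
    change c * ξ x = 0
    rw [hξ x hx, mul_zero]

theorem finiteDimensional_supportedBelow [∀ n, Fintype (I n)] (K : ℕ) :
    FiniteDimensional ℂ (supportedBelow b K) := by
  let X := {x : RestrictedProd b // ∀ n, K ≤ n → x.1 n = b n}
  have hX : Finite X := by
    refine Finite.of_injective (β := ∀ n : Fin K, I n) (fun x n => x.1.1 n) ?_
    intro x y h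
    refine Subtype.ext (Subtype.ext (funext fun n => ?_))
    rcases lt_or_ge n K with hn | hn
    · exact congrFun h ⟨n, hn⟩
    · rw [x.2 n hn, y.2 n hn]
  let r : supportedBelow b K →ₗ[ℂ] (X → ℂ) :=
    { toFun := fun ξ x => ξ.1 x.1
      map_add' := fun _ _ => rfl
      map_smul' := fun _ _ => rfl }
  refine FiniteDimensional.of_injective r ?_
  intro ξ η h
  refine Subtype.ext (lp.ext (funext fun x => ?_))
  by_cases hx : ∃ n, K ≤ n ∧ x.1 n ≠ b n
  · rw [ξ.2 x hx, η.2 x hx]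
  · push Not at hx
    exact congrFun h ⟨x, hx⟩

variable {b} [∀ n, DecidableEq (I n)] [∀ n, Fintype (I n)]

theorem leg_mem_supportedBelow {n K : ℕ} (h : n < K) (M : Matrix (I n) (I n) ℂ)
    {ξ : TensorHilbert b} (hξ : ξ ∈ supportedBelow b K) :
    leg b n M ξ ∈ supportedBelow b K := by
  rintro x ⟨m, hm, hx⟩
  rw [leg_apply]
  refine Finset.sum_eq_zero fun j _ => ?_
  rw [hξ _ ⟨m, hm, ?_⟩, mul_zero]
  change Function.update x.1 n j m ≠ b m
  rwa [Function.update_of_ne (by omega)]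

/-- Every element of the algebraic tensor product acts on only finitely many factors. -/
theorem eventually_mapsTo_supportedBelow {T : TensorHilbert b →L[ℂ] TensorHilbert b}
    (hT : T ∈ StarAlgebra.adjoin ℂ (⋃ n, Set.range (leg b n))) :
    ∀ᶠ K in atTop, ∀ ξ ∈ supportedBelow b K, T ξ ∈ supportedBelow b K := by
  -- The adjoint is carried along because the star case of the induction needs it.
  suffices h : ∀ᶠ K in atTop, ∀ ξ ∈ supportedBelow b K,
      T ξ ∈ supportedBelow b K ∧ star T ξ ∈ supportedBelow b K from
    h.mono fun K hK ξ hξ => (hK ξ hξ).1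
  induction hT using StarAlgebra.adjoin_induction with
  | mem T hT =>
    obtain ⟨n, M, rfl⟩ := Set.mem_iUnion.1 hT
    filter_upwards [eventually_gt_atTop n] with K hK ξ hξ
    rw [← map_star]
    exact ⟨leg_mem_supportedBelow hK M hξ, leg_mem_supportedBelow hK _ hξ⟩
  | algebraMap r =>
    refine Eventually.of_forall fun K ξ hξ => ?_
    rw [← algebraMap_star_comm, ContinuousLinearMap.algebraMap_apply,
      ContinuousLinearMap.algebraMap_apply]
    exact ⟨Submodule.smul_mem _ _ hξ, Submodule.smul_mem _ _ hξ⟩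
  | add S T _ _ hS hT =>
    filter_upwards [hS, hT] with K hS hT ξ hξ
    rw [star_add]
    exact ⟨Submodule.add_mem _ (hS ξ hξ).1 (hT ξ hξ).1,
      Submodule.add_mem _ (hS ξ hξ).2 (hT ξ hξ).2⟩
  | mul S T _ _ hS hT =>
    filter_upwards [hS, hT] with K hS hT ξ hξ
    rw [star_mul]
    exact ⟨(hS _ (hT ξ hξ).1).1, (hT _ (hS ξ hξ).2).2⟩
  | star T _ hT =>
    filter_upwards [hT] with K hT ξ hξ
    rw [star_star]
    exact ⟨(hT ξ hξ).2, (hT ξ hξ).1⟩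

end Support

/-! ### Equivariant functions -/

section Equivariant

variable {G : Type*}

/-- The sequence of base points. -/
def basePoint (G : Type*) : RestrictedProd (factorBase G) := ⟨factorBase G, by simp⟩

theorem eq_basePoint {x : RestrictedProd (factorBase G)} (hx : ¬ ∃ n, (x.1 n).isLeft) :
    x = basePoint G := by
  refine Subtype.ext (funext fun n => ?_)
  rcases h : x.1 n with t | t
  · exact absurd ⟨n, by rw [h]; rfl⟩ hx
  · rfl

variable [Group G]

/-- For `ζ` a root of unity of order dividing that of `g`, there is a unimodular function on `G`
that is multiplied by `ζ` under left translation by `g`. -/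
theorem exists_unimodular_translate_eq_mul (g : G) {ζ : ℂ} (hζ : ζ ^ orderOf g = 1)
    (h1 : ‖ζ‖ = 1) :
    ∃ c : G → ℂ, (∀ h, ‖c h‖ = 1) ∧ ∀ h, c (g * h) = ζ * c h := by
  have hz : ζ ≠ 0 := by
    rintro rfl
    simp at h1
  let s := MulAction.orbitRel (Subgroup.zpowers g) G
  -- The exponent relative to an orbit representative is determined only modulo `orderOf g`, which
  -- suffices since `ζ ^ orderOf g = 1`.
  have ex : ∀ h : G, ∃ i : ℤ, h = g ^ i * (Quotient.mk s h).out := by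
    intro h
    have : s h (Quotient.mk s h).out := s.symm (Quotient.mk_out (s := s) h)
    obtain ⟨⟨z, i, rfl⟩, hz⟩ := MulAction.orbitRel_apply.1 this
    exact ⟨i, hz.symm⟩
  choose i hi using ex
  refine ⟨fun h => ζ ^ i h, fun h => by simp [norm_zpow, h1], fun h => ?_⟩
  have hq : Quotient.mk s (g * h) = Quotient.mk s h :=
    Quotient.sound (MulAction.orbitRel_apply.2 ⟨⟨g, Subgroup.mem_zpowers g⟩, rfl⟩)
  have h2 : g ^ i (g * h) = g ^ (1 + i h) := by
    refine mul_right_cancel (b := (Quotient.mk s h).out) ?_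
    rw [zpow_one_add, mul_assoc, ← hi h]
    exact (hq ▸ hi (g * h)).symm
  change ζ ^ i (g * h) = ζ * ζ ^ i h
  rw [← zpow_one_add₀ hz]
  rw [zpow_eq_zpow_iff_modEq] at h2
  obtain ⟨k, hk⟩ := h2.dvd
  rw [show 1 + i h = i (g * h) + orderOf g * k by rw [← hk]; ring, zpow_add₀ hz, zpow_mul,
    zpow_natCast, hζ, one_zpow, mul_one]

/-- The first entry of a tuple of group elements, and `1` for the extra point. -/
def headEntry {n : ℕ} : FactorIndex G n → G := Sum.elim (fun t => t 0) fun _ => 1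

open Classical in
/-- The first group element that occurs in a sequence other than the base point. -/
def leadingEntry (x : RestrictedProd (factorBase G)) : G :=
  if h : ∃ n, (x.1 n).isLeft then headEntry (x.1 (Nat.find h)) else 1

/-- Translation does not change which coordinates are tuples, so the first such coordinate is the
same for both sequences. -/
theorem leadingEntry_leftShift (g : G) {x : RestrictedProd (factorBase G)}
    (hx : ∃ n, (x.1 n).isLeft) :
    leadingEntry (leftShift g x) = g * leadingEntry x := by
  classical
  have key : ∀ n, ((leftShift g x).1 n).isLeft ↔ (x.1 n).isLeft := by
    intro n
    change (factorShift n g (x.1 n)).isLeft ↔ _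
    cases x.1 n <;> exact Iff.rfl
  have hx' : ∃ n, ((leftShift g x).1 n).isLeft := by simpa only [key] using hx
  have hn : Nat.find hx' = Nat.find hx := Nat.find_congr' (fun {n} => key n)
  rw [leadingEntry, leadingEntry, dif_pos hx, dif_pos hx', hn]
  obtain ⟨t, ht⟩ := Sum.isLeft_iff.1 (Nat.find_spec hx)
  change headEntry (factorShift _ g (x.1 _)) = _
  rw [ht]
  rfl

/-- Away from the base point `leadingEntry` is an equivariant map to `G`, along which the function
on `G` is pulled back. -/
theorem exists_unimodular_leftShift_eq_mul (g : G) {ζ : ℂ} (hζ : ζ ^ orderOf g = 1)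
    (h1 : ‖ζ‖ = 1) :
    ∃ c : RestrictedProd (factorBase G) → ℂ, (∀ x, ‖c x‖ = 1) ∧
      ∀ x, (∃ n, (x.1 n).isLeft) → c (leftShift g x) = ζ * c x := by
  obtain ⟨c, hc, hcg⟩ := exists_unimodular_translate_eq_mul g hζ h1
  refine ⟨fun x => c (leadingEntry x), fun x => hc _, fun x hx => ?_⟩
  change c (leadingEntry (leftShift g x)) = _
  rw [leadingEntry_leftShift g hx, hcg]

theorem leftShift_basePoint (g : G) : leftShift g (basePoint G) = basePoint G :=
  Subtype.ext (funext fun _ => rfl)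

end Equivariant

/-! ### Multiplicities of eigenvalues -/

section Multiplicity

variable {G : Type*} [Group G]

/-- Multiplication by a unimodular function. -/
def mulUnimodular {X : Type*} (c : X → ℂ) (hc : ∀ x, ‖c x‖ = 1) :
    lp (fun _ : X => ℂ) 2 →ₗ[ℂ] lp (fun _ : X => ℂ) 2 where
  toFun ξ := ⟨fun x => c x * ξ x, by
    refine memℓp_gen ?_
    simp only [norm_mul, hc, one_mul]
    exact (memℓp_gen_iff (by simp)).1 (lp.memℓp ξ)⟩
  map_add' ξ η := by
    ext x
    exact mul_add (c x) (ξ x) (η x)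
  map_smul' r ξ := by
    ext x
    exact mul_left_comm (c x) r (ξ x)

variable [Fintype G] [DecidableEq G]

/-- An operator of the algebraic tensor product that is an eigenvector of `Ad(U_g)`, with an
eigenvalue other than `1` of order dividing that of `g`, is not bounded below: in a finite stage,
the fixed space of `U_g` has one dimension more than its other eigenspaces. -/
theorem one_le_norm_star_mul_self_sub_one {g : G} {ζ : ℂ} (hζ : ζ ^ orderOf g = 1) (h1 : ‖ζ‖ = 1)
    (hne : ζ ≠ 1) {T : TensorHilbert (factorBase G) →L[ℂ] TensorHilbert (factorBase G)}
    (hT : T ∈ StarAlgebra.adjoin ℂ (⋃ n, Set.range (leg (factorBase G) n)))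
    (hgT : (tensorUnitary g).conjStarAlgEquiv T = ζ • T) : 1 ≤ ‖star T * T - 1‖ := by
  by_contra! hlt
  have hz : ζ ≠ 0 := by
    rintro rfl
    simp at h1
  -- On the kernel of `T` the operator `star T * T - 1` is `-1`, which is incompatible with norm
  -- less than one.
  have inj : ∀ ξ, T ξ = 0 → ξ = 0 := by
    intro ξ hξ
    by_contra h0
    have h2 : (star T * T - 1) ξ = -ξ := by
      change star T (T ξ) - ξ = -ξ
      rw [hξ, map_zero, zero_sub]
    have h3 := (star T * T - 1).le_opNorm ξ
    rw [h2, norm_neg] at h3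
    have h4 : 0 < ‖ξ‖ := norm_pos_iff.2 h0
    nlinarith
  obtain ⟨K, hK⟩ := (eventually_mapsTo_supportedBelow hT).exists
  obtain ⟨c, hc, hcg⟩ := exists_unimodular_leftShift_eq_mul g
    (ζ := ζ) hζ h1
  -- The fixed space of `U_g` in a finite stage preserved by `T`.
  let V : Submodule ℂ (TensorHilbert (factorBase G)) :=
    { carrier := {ξ | ξ ∈ supportedBelow (factorBase G) K ∧ ∀ x, ξ (leftShift g x) = ξ x}
      zero_mem' := ⟨Submodule.zero_mem _, fun _ => rfl⟩
      add_mem' := fun {ξ η} hξ hη => ⟨Submodule.add_mem _ hξ.1 hη.1, fun x => by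
        change ξ _ + η _ = ξ _ + η _
        rw [hξ.2, hη.2]⟩
      smul_mem' := fun r ξ hξ => ⟨Submodule.smul_mem _ r hξ.1, fun x => by
        change r * ξ _ = r * ξ _
        rw [hξ.2]⟩ }
  have hfin : FiniteDimensional ℂ V := by
    have := finiteDimensional_supportedBelow (factorBase G) K
    exact Submodule.finiteDimensional_of_le (S₂ := supportedBelow (factorBase G) K)
      fun ξ hξ => hξ.1
  -- `T` maps fixed vectors of `U_g` into its `ζ`-eigenspace.
  have heig : ∀ ξ ∈ V, ∀ x, T ξ x = ζ * T ξ (leftShift g x) := by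
    intro ξ hξ x
    have h2 := congrArg (fun S : TensorHilbert (factorBase G) →L[ℂ] TensorHilbert (factorBase G) =>
      S ξ (leftShift g x)) hgT
    have h3 : (tensorUnitary g).symm ξ = ξ := by
      ext x
      rw [tensorUnitary_symm_apply, hξ.2]
    simp only [LinearIsometryEquiv.conjStarAlgEquiv_apply_apply, tensorUnitary_apply, h3,
      ← leftShift_mul, inv_mul_cancel, leftShift_one] at h2
    exact h2
  -- The base point is fixed by `g`, so an eigenvector for `ζ ≠ 1` vanishes there.
  have hbase : ∀ ξ ∈ V, T ξ (basePoint G) = 0 := by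
    intro ξ hξ
    have h2 := heig ξ hξ (basePoint G)
    rw [leftShift_basePoint] at h2
    have h3 : (1 - ζ) * T ξ (basePoint G) = 0 := by linear_combination h2
    exact (mul_eq_zero.1 h3).resolve_left (sub_ne_zero.2 hne.symm)
  -- Multiplication by `c` turns the `ζ`-eigenvectors back into fixed vectors. The dimension count
  -- thus becomes a statement about an injective endomorphism of `V` whose values all vanish at the
  -- base point.
  let S : V →ₗ[ℂ] V := (mulUnimodular c hc ∘ₗ T.toLinearMap).restrict (p := V) (q := V) (by
    intro ξ hξ
    refine ⟨fun x hx => ?_, fun x => ?_⟩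
    · change c x * T ξ x = 0
      rw [hK ξ hξ.1 x hx, mul_zero]
    · change c (leftShift g x) * T ξ (leftShift g x) = c x * T ξ x
      by_cases hx : ∃ n, (x.1 n).isLeft
      · rw [hcg x hx, heig ξ hξ x]
        ring
      · rw [eq_basePoint hx, leftShift_basePoint])
  have hSinj : Function.Injective S := by
    rw [← LinearMap.ker_eq_bot, LinearMap.ker_eq_bot']
    intro ξ hξ
    refine Subtype.ext (inj _ (lp.ext (funext fun x => ?_)))
    have h2 : c x * T ξ.1 x = 0 := congrArg (fun η : V => η.1 x) hξ
    refine (mul_eq_zero.1 h2).resolve_left fun h3 => ?_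
    have := hc x
    simp [h3] at this
  classical
  have hδ : lp.single 2 (basePoint G) (1 : ℂ) ∈ V := by
    refine ⟨fun x ⟨n, _, hn⟩ => ?_, fun x => ?_⟩
    · refine lp.single_apply_ne 2 _ _ ?_
      rintro rfl
      exact hn rfl
    · by_cases hx : x = basePoint G
      · rw [hx, leftShift_basePoint]
      · rw [lp.single_apply_ne 2 _ _ hx, lp.single_apply_ne 2]
        intro h2
        apply hx
        rw [← leftShift_one x, ← inv_mul_cancel g, leftShift_mul, h2, leftShift_basePoint]
  -- In finite dimension injectivity would put the basis vector at the base point into the range.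
  obtain ⟨ξ, hξ⟩ := LinearMap.surjective_of_injective hSinj ⟨_, hδ⟩
  have h2 : c (basePoint G) * T ξ.1 (basePoint G) = 1 :=
    (congrArg (fun η : V => η.1 (basePoint G)) hξ).trans (lp.single_apply_self 2 _ _)
  rw [hbase _ ξ.2, mul_zero] at h2
  exact zero_ne_one h2

end Multiplicity

/-! ### The Rokhlin property fails -/

namespace Ultrapower

variable (ω : Ultrafilter ℕ) {A : Type*} [CStarAlgebra A]

theorem star_mk (a : ℕ →ᵇ A) :
    star (Ideal.Quotient.mk (nullIdeal ω A) a) = Ideal.Quotient.mk (nullIdeal ω A) (star a) := rfl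

theorem mk_smul (c : ℂ) (a : ℕ →ᵇ A) :
    Ideal.Quotient.mk (nullIdeal ω A) (c • a) = c • Ideal.Quotient.mk (nullIdeal ω A) a := rfl

theorem map_mk (φ : A ≃⋆ₐ[ℂ] A) (a : ℕ →ᵇ A) :
    map ω φ (Ideal.Quotient.mk (nullIdeal ω A) a) =
      Ideal.Quotient.mk (nullIdeal ω A) (seqMap φ a) := rfl

theorem seqMap_apply (φ : A ≃⋆ₐ[ℂ] A) (a : ℕ →ᵇ A) (n : ℕ) : seqMap φ a n = φ (a n) := rfl

theorem IsPositiveContraction.star_eq {ω : Ultrafilter ℕ} {f : Ultrapower ω A}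
    (hf : IsPositiveContraction ω f) : star f = f := by
  obtain ⟨⟨x, rfl⟩, -⟩ := hf
  rw [star_mul, star_star]

end Ultrapower

/-! ### Eigenvectors of the action built from Rokhlin projections -/

section Twisted

variable {G A : Type*} [Group G] [Fintype G] [CStarAlgebra A]

/-- The average of the translates of `x`, weighted by the conjugates of `c`. -/
def twistedSum (α : G →* (A ≃⋆ₐ[ℂ] A)) (c : G → ℂ) (x : A) : A := ∑ h, star (c h) • α h x

/-- Reindex the sum by `h ↦ g * h`. The relation is exact for every `x`, so `x` can later be
perturbed without losing it. -/
theorem map_twistedSum (α : G →* (A ≃⋆ₐ[ℂ] A)) {c : G → ℂ} {g : G} {ζ : ℂ} (h1 : ‖ζ‖ = 1)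
    (hc : ∀ h, c (g * h) = ζ * c h) (x : A) :
    α g (twistedSum α c x) = ζ • twistedSum α c x := by
  have hz : ζ * star ζ = 1 := by
    rw [Complex.star_def, Complex.mul_conj, Complex.normSq_eq_norm_sq, h1]
    simp
  rw [twistedSum, map_sum, ← Equiv.sum_comp (Equiv.mulLeft g) (fun h => star (c h) • α h x),
    Finset.smul_sum]
  refine Finset.sum_congr rfl fun h _ => ?_
  rw [map_smul, Equiv.coe_mulLeft, hc, map_mul, star_mul', smul_smul, ← mul_assoc, hz, one_mul]
  rfl

theorem continuous_twistedSum (α : G →* (A ≃⋆ₐ[ℂ] A)) (c : G → ℂ) :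
    Continuous (twistedSum α c) := by
  refine continuous_finsetSum _ fun h _ => Continuous.const_smul ?_ _
  exact AddMonoidHomClass.continuous_of_bound (α h) 1 fun T => by
    simpa using NonUnitalStarAlgHom.norm_apply_le (α h) T

/-- If the Rokhlin dimension is zero, then there are almost isometric twisted sums. -/
theorem DimRokLE.exists_twistedSum {ω : Ultrafilter ℕ} {α : G →* (A ≃⋆ₐ[ℂ] A)}
    (hα : DimRokLE ω α 0) {c : G → ℂ} (hc : ∀ h, ‖c h‖ = 1) :
    ∃ x, ‖star (twistedSum α c x) * twistedSum α c x - 1‖ < 1 := by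
  classical
  -- The trivial subgroup gives a tower indexed by `G` itself.
  obtain ⟨f, hpos, -, hmap, horth, hsum⟩ := hα ⊥ inferInstance inferInstance
  let F : G → Ultrapower ω A := fun h => f 0 (h : G ⧸ (⊥ : Subgroup G))
  have hbij : Function.Bijective fun h : G => (h : G ⧸ (⊥ : Subgroup G)) :=
    ⟨fun a b h => by simpa [inv_mul_eq_one] using QuotientGroup.eq.1 h,
      QuotientGroup.mk_surjective⟩
  have hF1 : ∑ h, F h = 1 := by
    rw [← hsum]
    simp only [Fin.sum_univ_succ, Finset.univ_eq_empty, Finset.sum_empty, add_zero]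
    rw [← finsum_eq_sum_of_fintype]
    exact finsum_eq_of_bijective _ hbij fun _ => rfl
  have hFo : ∀ h k, h ≠ k → F h * F k = 0 := fun h k hhk =>
    horth 0 _ _ (hbij.1.ne hhk)
  -- Multiply the partition of unity by `F h`; orthogonality leaves only the square.
  have hFi : ∀ h, F h * F h = F h := by
    intro h
    conv_rhs => rw [← mul_one (F h), ← hF1, Finset.mul_sum]
    exact (Finset.sum_eq_single h (fun k _ hk => hFo h k hk.symm) (by simp)).symm
  obtain ⟨a, ha⟩ := Ideal.Quotient.mk_surjective (F 1)
  have hFa : ∀ h, F h = Ideal.Quotient.mk (nullIdeal ω A) (Ultrapower.seqMap (α h) a) := by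
    intro h
    rw [← Ultrapower.map_mk, ha, hmap]
    change f 0 _ = f 0 ((h * 1 : G) : G ⧸ (⊥ : Subgroup G))
    rw [mul_one]
  let y : ℕ →ᵇ A := ∑ h, star (c h) • Ultrapower.seqMap (α h) a
  have hy : ∀ n, y n = twistedSum α c (a n) := by
    intro n
    simp [y, twistedSum, Ultrapower.seqMap_apply]
  have hmk : Ideal.Quotient.mk (nullIdeal ω A) y = ∑ h, star (c h) • F h := by
    simp only [y, map_sum, Ultrapower.mk_smul, hFa]
  have hmk' : Ideal.Quotient.mk (nullIdeal ω A) (star y) = ∑ h, c h • F h := by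
    simp only [y, star_sum, star_smul, star_star, map_sum, Ultrapower.mk_smul,
      ← Ultrapower.star_mk, ← hFa, (hpos _ _).star_eq, F]
  -- In the ultrapower the cross terms vanish and the coefficients are unimodular, leaving the sum
  -- of the projections.
  have hnull : star y * y - 1 ∈ nullIdeal ω A := by
    rw [← Ideal.Quotient.eq, map_mul, hmk, hmk', map_one, Finset.sum_mul, ← hF1]
    refine Finset.sum_congr rfl fun h _ => ?_
    rw [Finset.mul_sum, Finset.sum_eq_single h]
    · rw [smul_mul_smul_comm, hFi, Complex.star_def, Complex.mul_conj, Complex.normSq_eq_norm_sq, hc]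
      simp
    · intro k _ hk
      rw [smul_mul_smul_comm, hFo h k hk.symm, smul_zero]
    · simp
  obtain ⟨n, hn⟩ := ((mem_nullIdeal.1 hnull).eventually_lt_const one_pos).exists
  refine ⟨a n, ?_⟩
  rw [← hy]
  exact hn

end Twisted

/-! ### Approximation by the algebraic tensor product -/

section NotZero

variable {G : Type*} [Group G] [Fintype G] [DecidableEq G]

theorem coe_twistedSum (c : G → ℂ) (x : productAlgebra G) :
    (twistedSum (productAction G) c x).1 =
      ∑ h, star (c h) • (tensorUnitary h).conjStarAlgEquiv x.1 := by
  rw [twistedSum, AddSubmonoidClass.coe_finsetSum]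
  rfl

theorem conjUnitary_mem_adjoin (g : G)
    {T : TensorHilbert (factorBase G) →L[ℂ] TensorHilbert (factorBase G)}
    (hT : T ∈ StarAlgebra.adjoin ℂ (⋃ n, Set.range (leg (factorBase G) n))) :
    (tensorUnitary g).conjStarAlgEquiv T ∈
      StarAlgebra.adjoin ℂ (⋃ n, Set.range (leg (factorBase G) n)) := by
  let ψ : (TensorHilbert (factorBase G) →L[ℂ] TensorHilbert (factorBase G)) →⋆ₐ[ℂ]
    (TensorHilbert (factorBase G) →L[ℂ] TensorHilbert (factorBase G)) :=
    (tensorUnitary g).conjStarAlgEquiv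
  suffices h : StarAlgebra.adjoin ℂ (⋃ n, Set.range (leg (factorBase G) n)) ≤
      (StarAlgebra.adjoin ℂ (⋃ n, Set.range (leg (factorBase G) n))).comap ψ from h hT
  refine StarAlgebra.adjoin_le (Set.iUnion_subset fun n => ?_)
  rintro _ ⟨M, rfl⟩
  change (tensorUnitary g).conjStarAlgEquiv (leg (factorBase G) n M) ∈
    StarAlgebra.adjoin ℂ (⋃ n, Set.range (leg (factorBase G) n))
  rw [conj_leg]
  exact StarAlgebra.subset_adjoin ℂ _ (Set.mem_iUnion.2 ⟨n, _, rfl⟩)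

/-- The elements of the algebraic tensor product are dense. -/
theorem dense_adjoin_leg : Dense {x : productAlgebra G |
    x.1 ∈ StarAlgebra.adjoin ℂ (⋃ n, Set.range (leg (factorBase G) n))} := by
  intro x
  rw [closure_subtype]
  refine closure_mono ?_ (show x.1 ∈ closure (StarAlgebra.adjoin ℂ
    (⋃ n, Set.range (leg (factorBase G) n)) : Set (TensorHilbert (factorBase G) →L[ℂ] _)) from x.2)
  intro T hT
  exact ⟨⟨T, StarSubalgebra.le_topologicalClosure _ hT⟩, hT, rfl⟩

theorem not_dimRokLE_zero [Nontrivial G] (ω : Ultrafilter ℕ) :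
    ¬ DimRokLE ω (productAction G) 0 := by
  intro hα
  obtain ⟨g, hg⟩ := exists_ne (1 : G)
  have hm : orderOf g ≠ 0 := (orderOf_pos g).ne'
  have hprim := Complex.isPrimitiveRoot_exp (orderOf g) hm
  set ζ := Complex.exp (2 * Real.pi * Complex.I / orderOf g)
  have h1 : ‖ζ‖ = 1 := hprim.norm'_eq_one hm
  -- `ζ` is primitive of order `orderOf g`, so `ζ = 1` would force `g = 1`.
  have hne : ζ ≠ 1 := fun h => hg (orderOf_eq_one_iff.1 (by simpa [h] using hprim.eq_orderOf))
  obtain ⟨c, hc, hcg⟩ := exists_unimodular_translate_eq_mul g hprim.pow_eq_one h1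
  obtain ⟨x₀, hx₀⟩ := hα.exists_twistedSum hc
  have hcont := continuous_twistedSum (productAction G) c
  have hopen : IsOpen {x | ‖star (twistedSum (productAction G) c x) *
      twistedSum (productAction G) c x - 1‖ < 1} :=
    isOpen_lt ((hcont.star.mul hcont).sub continuous_const).norm continuous_const
  -- Being almost isometric is an open condition on `x`, so it is met inside the dense algebraic
  -- tensor product.
  obtain ⟨x, hx, hmem⟩ := dense_adjoin_leg.inter_open_nonempty _ hopen ⟨x₀, hx₀⟩
  refine absurd hx (not_lt.2 (one_le_norm_star_mul_self_sub_one
    (T := (twistedSum (productAction G) c x).1) hprim.pow_eq_one h1 hne ?_ ?_))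
  · rw [coe_twistedSum]
    exact sum_mem fun h _ => SMulMemClass.smul_mem _ (conjUnitary_mem_adjoin h hmem)
  · exact congrArg Subtype.val (map_twistedSum (productAction G) h1 hcg x)

end NotZero

/-! ### Two Rokhlin towers in `ℓ²(G) ⊗ ℂ^k ⊕ ℂ` -/

section Towers

open Matrix
open scoped Kronecker

variable {k : ℕ}

/-- The backward shift on `ℂ^k`. -/
def backwardShift (k : ℕ) : Matrix (Fin k) (Fin k) ℂ :=
  of fun j i => if j.1 + 1 = i.1 then 1 else 0

/-- The projection of `ℂ^k` onto the span of its first basis vector. -/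
def firstProj (k : ℕ) : Matrix (Fin k) (Fin k) ℂ :=
  of fun i j => if i.1 = 0 ∧ j.1 = 0 then 1 else 0

theorem backwardShift_star_mul_self :
    (backwardShift k)ᴴ * backwardShift k = 1 - firstProj k := by
  ext i j
  simp only [mul_apply, conjTranspose_apply, backwardShift, firstProj, of_apply, Matrix.sub_apply,
    one_apply, Fin.ext_iff, apply_ite star, star_one, star_zero, ite_mul, one_mul, zero_mul]
  by_cases h : i.1 = 0
  · rw [Finset.sum_eq_zero fun l _ => by rw [if_neg (by omega)]]
    by_cases h' : j.1 = 0
    · rw [if_pos (by omega), if_pos ⟨h, h'⟩, sub_self]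
    · rw [if_neg (by omega), if_neg (by omega), sub_self]
  · rw [Finset.sum_eq_single ⟨i.1 - 1, by omega⟩]
    · simp only [show i.1 - 1 + 1 = i.1 by omega, h, if_true, false_and, if_false, sub_zero]
    · intro l _ hl
      rw [if_neg]
      intro h'
      exact hl (Fin.ext (by simp; omega))
    · simp

/-- The weights of the two towers: `i / k` for the first one, `1 - i / k` for the second one. -/
def towerWeight (k : ℕ) : Fin 2 → Fin k → ℝ :=
  ![fun i => i.1 / k, fun i => 1 - i.1 / k]

theorem towerWeight_mem (r : Fin 2) (i : Fin k) : towerWeight k r i ∈ Set.Icc (0 : ℝ) 1 := by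
  have hk : (0 : ℝ) < k := by exact_mod_cast i.pos
  have h1 : (i.1 : ℝ) / k ≤ 1 := (div_le_one hk).2 (by exact_mod_cast i.2.le)
  have h0 : (0 : ℝ) ≤ i.1 / k := by positivity
  match r with
  | 0 => exact ⟨h0, h1⟩
  | 1 => exact ⟨sub_nonneg.2 h1, sub_le_self 1 h0⟩

/-- The weights of a tower as a diagonal matrix. -/
def weightMatrix (d : Fin k → ℝ) : Matrix (Fin k) (Fin k) ℂ := diagonal fun i => (d i : ℂ)

/-- The shift gives index `i` the weight `1 - (i + 1) / k`. The last index receives nothing, which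
agrees with this formula because the weight at `i + 1 = k` would be zero. -/
theorem backwardShift_mul_weight_mul_star :
    backwardShift k * weightMatrix (towerWeight k 1) * (backwardShift k)ᴴ =
      (1 - (k : ℂ)⁻¹) • 1 - weightMatrix (towerWeight k 0) := by
  ext i j
  have hk : (k : ℂ) ≠ 0 := by exact_mod_cast i.pos.ne'
  rw [mul_apply]
  simp only [weightMatrix, mul_diagonal, conjTranspose_apply, backwardShift, of_apply,
    Matrix.sub_apply, Matrix.smul_apply, one_apply, diagonal_apply, Fin.ext_iff, apply_ite star, star_one,
    star_zero, ite_mul, one_mul, zero_mul, mul_ite, mul_one, mul_zero, smul_eq_mul]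
  by_cases h : i.1 + 1 < k
  · rw [Finset.sum_eq_single ⟨i.1 + 1, h⟩]
    · by_cases hij : i.1 = j.1
      · simp only [hij, if_true, towerWeight, cons_val_one, cons_val_zero, cons_val_fin_one]
        push_cast
        field_simp
        ring
      · simp [hij, Ne.symm hij]
    · intro l _ hl
      have : i.1 + 1 ≠ l.1 := fun h' => hl (Fin.ext h'.symm)
      simp [this]
    · simp
  · rw [Finset.sum_eq_zero fun l _ => by
      rw [if_neg (show ¬ i.1 + 1 = l.1 by omega), ite_self]]
    by_cases hij : i.1 = j.1
    · have hi : (i.1 : ℂ) = k - 1 := by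
        rw [eq_sub_iff_add_eq]
        exact_mod_cast (show i.1 + 1 = k by omega)
      simp only [hij, if_true, towerWeight, cons_val_zero]
      rw [hij] at hi
      push_cast
      rw [hi]
      field_simp
      ring
    · simp [hij]

variable (G : Type*) [Fintype G]

/-- The projection of `ℓ²(G)` onto the constant functions. -/
def avgProj : Matrix G G ℂ := of fun _ _ => (Fintype.card G : ℂ)⁻¹

theorem avgProj_star : (avgProj G)ᴴ = avgProj G := by
  ext
  simp [avgProj]

theorem avgProj_mul_self [Nonempty G] : avgProj G * avgProj G = avgProj G := by
  ext
  simp [avgProj, mul_apply]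

/-- The component `ℓ²(G) ⊗ ℂ^k → ℓ²(G) ⊗ ℂ^k` of `towerIsometry`. -/
def towerCorner [DecidableEq G] (k : ℕ) : Matrix (G × Fin k) (G × Fin k) ℂ :=
  (1 - avgProj G) ⊗ₖ 1 + avgProj G ⊗ₖ backwardShift k

/-- The component `ℓ²(G) ⊗ ℂ^k → ℂ` of `towerIsometry`. -/
def towerRow (k : ℕ) : Matrix Unit (G × Fin k) ℂ :=
  of fun _ x => if x.2.1 = 0 then ((√(Fintype.card G) : ℝ) : ℂ)⁻¹ else 0

/-- The partial isometry of `ℓ²(G) ⊗ ℂ^k ⊕ ℂ` with support `ℓ²(G) ⊗ ℂ^k` that is the identity on the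
orthogonal complement of the invariant vectors and shifts the invariant vectors by one step, so that
the extra vector is hit. -/
def towerIsometry [DecidableEq G] (k : ℕ) : Matrix ((G × Fin k) ⊕ Unit) ((G × Fin k) ⊕ Unit) ℂ :=
  fromBlocks (towerCorner G k) 0 (towerRow G k) 0

variable {G}

theorem towerRow_star_mul_self :
    (towerRow G k)ᴴ * towerRow G k = avgProj G ⊗ₖ firstProj k := by
  ext ⟨g, i⟩ ⟨h, j⟩
  simp only [mul_apply, conjTranspose_apply, towerRow, of_apply, kroneckerMap_apply, avgProj,
    firstProj, Finset.univ_unique, Finset.sum_singleton]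
  by_cases hi : i.1 = 0 <;> by_cases hj : j.1 = 0 <;> simp [hi, hj]
  rw [← mul_inv, ← Complex.ofReal_mul, Real.mul_self_sqrt (Nat.cast_nonneg _)]
  simp

/-- The adjoint of `towerRow` is constant in the group variable and lives on the first basis vector
of `ℂ^k`; it is killed by vanishing row sums of `M` or by a vanishing first column of `N`. -/
theorem kronecker_mul_towerRow_star (M : Matrix G G ℂ) (N : Matrix (Fin k) (Fin k) ℂ)
    (h : (∀ g, ∑ h, M g h = 0) ∨ ∀ i j : Fin k, j.1 = 0 → N i j = 0) :
    (M ⊗ₖ N) * (towerRow G k)ᴴ = 0 := by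
  ext ⟨g, i⟩ u
  simp only [mul_apply, Fintype.sum_prod_type, kroneckerMap_apply, conjTranspose_apply, towerRow,
    of_apply, Matrix.zero_apply]
  rcases h with h | h
  · rw [Finset.sum_comm]
    refine Finset.sum_eq_zero fun j _ => ?_
    by_cases hj : j.1 = 0
    · simp only [hj, if_true]
      rw [← Finset.sum_mul, ← Finset.sum_mul, h, zero_mul, zero_mul]
    · simp [hj]
  · refine Finset.sum_eq_zero fun g' _ => Finset.sum_eq_zero fun j _ => ?_
    by_cases hj : j.1 = 0
    · rw [h i j hj, mul_zero, zero_mul]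
    · rw [if_neg hj, star_zero, mul_zero]

variable [DecidableEq G]

theorem towerCorner_star :
    (towerCorner G k)ᴴ = (1 - avgProj G) ⊗ₖ 1 + avgProj G ⊗ₖ (backwardShift k)ᴴ := by
  simp [towerCorner, conjTranspose_kronecker, avgProj_star]

variable [Nonempty G]

theorem sum_one_sub_avgProj (g : G) : ∑ h, (1 - avgProj G) g h = 0 := by
  simp [avgProj, one_apply]

/-- The backward shift loses exactly the invariant vectors over the first index, and `towerRow`
restores them by sending them isometrically to the extra vector. -/
theorem towerIsometry_star_mul_self :
    (towerIsometry G k)ᴴ * towerIsometry G k = fromBlocks 1 0 0 0 := by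
  have h : (towerCorner G k)ᴴ * towerCorner G k + (towerRow G k)ᴴ * towerRow G k = 1 := by
    rw [towerRow_star_mul_self, towerCorner_star, towerCorner, add_mul, mul_add, mul_add]
    simp only [← mul_kronecker_mul, sub_mul, mul_sub, one_mul, mul_one, avgProj_mul_self,
      sub_self, sub_zero, zero_kronecker, add_zero, zero_add, backwardShift_star_mul_self]
    rw [add_assoc, ← kronecker_add, sub_add_cancel, ← add_kronecker, sub_add_cancel,
      one_kronecker_one]
  simp [towerIsometry, fromBlocks_conjTranspose, fromBlocks_multiply, h]

/-- On the complement of the invariant vectors the weight stays `1 - i / k`; on the invariant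
vectors it drops by `1 / k`. The extra vector receives the weight of index `0`, which is `1`. -/
theorem towerIsometry_mul_weight_mul_star (hk : k ≠ 0) :
    towerIsometry G k * fromBlocks (1 ⊗ₖ weightMatrix (towerWeight k 1)) 0 0 0 *
      (towerIsometry G k)ᴴ =
    1 - (k : ℂ)⁻¹ • fromBlocks (avgProj G ⊗ₖ 1) 0 0 0 -
      fromBlocks (1 ⊗ₖ weightMatrix (towerWeight k 0)) 0 0 0 := by
  have e : towerCorner G k * 1 ⊗ₖ weightMatrix (towerWeight k 1) =
      (1 - avgProj G) ⊗ₖ weightMatrix (towerWeight k 1) +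
        avgProj G ⊗ₖ (backwardShift k * weightMatrix (towerWeight k 1)) := by
    rw [towerCorner, add_mul, ← mul_kronecker_mul, ← mul_kronecker_mul, mul_one, mul_one, one_mul]
  have h11 : towerCorner G k * 1 ⊗ₖ weightMatrix (towerWeight k 1) * (towerCorner G k)ᴴ =
      1 - (k : ℂ)⁻¹ • avgProj G ⊗ₖ 1 - 1 ⊗ₖ weightMatrix (towerWeight k 0) := by
    have e2 : weightMatrix (towerWeight k 1) = 1 - weightMatrix (towerWeight k 0) := by
      rw [weightMatrix, weightMatrix, ← diagonal_one, diagonal_sub]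
      simp [towerWeight]
    rw [e, towerCorner_star, add_mul, mul_add, mul_add]
    simp only [← mul_kronecker_mul, sub_mul, mul_sub, one_mul, mul_one, avgProj_mul_self,
      sub_self, sub_zero, zero_kronecker, add_zero, zero_add, backwardShift_mul_weight_mul_star]
    rw [e2]
    rw [← one_kronecker_one]
    ext ⟨g, i⟩ ⟨h, j⟩
    simp only [Matrix.add_apply, Matrix.sub_apply, Matrix.smul_apply, kroneckerMap_apply,
      smul_eq_mul]
    ring
  have h12 : towerCorner G k * 1 ⊗ₖ weightMatrix (towerWeight k 1) * (towerRow G k)ᴴ = 0 := by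
    rw [e, Matrix.add_mul, kronecker_mul_towerRow_star _ _ (Or.inl sum_one_sub_avgProj),
      kronecker_mul_towerRow_star _ _ (Or.inr fun i j hj => ?_), add_zero]
    simp [weightMatrix, mul_diagonal, backwardShift, hj]
  -- This is the adjoint of `h12`, since the weights are real.
  have h21 : towerRow G k * (1 : Matrix G G ℂ) ⊗ₖ weightMatrix (towerWeight k 1) * (towerCorner G k)ᴴ = 0 := by
    have h := congrArg conjTranspose h12
    rw [conjTranspose_mul, conjTranspose_mul, conjTranspose_kronecker, conjTranspose_conjTranspose,
      conjTranspose_one, conjTranspose_zero, weightMatrix, diagonal_conjTranspose, ← Matrix.mul_assoc] at h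
    rwa [show (star fun i => (towerWeight k 1 i : ℂ)) = fun i => (towerWeight k 1 i : ℂ) from
      funext fun i => Complex.conj_ofReal _] at h
  have h22 : towerRow G k * (1 : Matrix G G ℂ) ⊗ₖ weightMatrix (towerWeight k 1) * (towerRow G k)ᴴ = 1 := by
    ext
    rw [← diagonal_one, weightMatrix, diagonal_kronecker_diagonal, mul_apply,
      Fintype.sum_prod_type_right, Finset.sum_eq_single ⟨0, Nat.pos_of_ne_zero hk⟩]
    · have h0 : (Fintype.card G : ℂ) ≠ 0 := by exact_mod_cast Fintype.card_ne_zero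
      simp only [mul_diagonal, towerRow, of_apply, conjTranspose_apply, if_true, towerWeight]
      rw [Finset.sum_const, nsmul_eq_mul]
      simp
      rw [← mul_inv, ← Complex.ofReal_mul, Real.mul_self_sqrt (Nat.cast_nonneg _)]
      simp [h0]
    · intro i _ hi
      have : i.1 ≠ 0 := fun h => hi (Fin.ext h)
      simp [towerRow, this]
    · simp
  rw [towerIsometry, fromBlocks_conjTranspose, fromBlocks_multiply, fromBlocks_multiply]
  simp only [Matrix.mul_zero, add_zero, conjTranspose_zero, h11, h12, h21, h22]
  rw [← fromBlocks_one, fromBlocks_smul]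
  ext (i | i) (j | j) <;> simp [one_apply]

end Towers

/-! ### Equivariance, orthogonality and positivity of the matrix towers -/

section RokhlinTowers

open Matrix
open scoped Kronecker Matrix.Norms.L2Operator

variable {G : Type*} [Group G] {H : Subgroup G}

open Classical in
/-- The diagonal weight `d`, restricted to the basis vectors of `ℓ²(G) ⊗ ℂ^k` that lie over a
coset. -/
def cosetWeight [DecidableEq G] {k : ℕ} (d : Fin k → ℝ) (q : G ⧸ H) :
    Matrix ((G × Fin k) ⊕ Unit) ((G × Fin k) ⊕ Unit) ℂ :=
  diagonal (Sum.elim (fun x => if (x.1 : G ⧸ H) = q then (d x.2 : ℂ) else 0) fun _ => 0)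

variable [DecidableEq G] {k : ℕ}

theorem sum_cosetWeight [Fintype (G ⧸ H)] (d : Fin k → ℝ) :
    ∑ q : G ⧸ H, cosetWeight d q = fromBlocks ((1 : Matrix G G ℂ) ⊗ₖ weightMatrix d) 0 0 0 := by
  rw [weightMatrix, ← diagonal_one, diagonal_kronecker_diagonal]
  ext (x | x) (y | y)
  · simp only [Matrix.sum_apply, cosetWeight, diagonal_apply, Sum.elim_inl, fromBlocks_apply₁₁,
      Sum.inl.injEq, one_mul]
    by_cases hxy : x = y <;> simp [hxy]
  · simp [Matrix.sum_apply, cosetWeight]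
  · simp [Matrix.sum_apply, cosetWeight]
  · simp [Matrix.sum_apply, cosetWeight]

theorem cosetWeight_conjTranspose (d : Fin k → ℝ) (q : G ⧸ H) :
    (cosetWeight d q)ᴴ = cosetWeight d q := by
  rw [cosetWeight, diagonal_conjTranspose]
  congr 1
  ext (x | x)
  · by_cases hx : (x.1 : G ⧸ H) = q <;> simp [hx]
  · simp

/-- Left translation on the basis of `ℓ²(G) ⊗ ℂ^k ⊕ ℂ`. -/
def towerShift (k : ℕ) (g : G) : Equiv.Perm ((G × Fin k) ⊕ Unit) :=
  Equiv.sumCongr (Equiv.prodCongr (Equiv.mulLeft g) (Equiv.refl _)) (Equiv.refl _)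

theorem cosetWeight_submatrix (d : Fin k → ℝ) (g : G) (q : G ⧸ H) :
    (cosetWeight d q).submatrix (towerShift k g⁻¹) (towerShift k g⁻¹) =
      cosetWeight d (g • q) := by
  rw [cosetWeight, submatrix_diagonal_equiv, cosetWeight]
  congr 1
  ext (x | x)
  · have h : ((g⁻¹ * x.1 : G) : G ⧸ H) = q ↔ (x.1 : G ⧸ H) = g • q :=
      @inv_smul_eq_iff G (G ⧸ H) _ _ g (x.1 : G ⧸ H) q
    simp only [Function.comp_apply, towerShift, Equiv.sumCongr_apply, Sum.map_inl, Sum.elim_inl]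
    classical exact if_congr h rfl rfl
  · rfl

variable [Fintype G]

theorem cosetWeight_mul_cosetWeight (d : Fin k → ℝ) {p q : G ⧸ H} (hpq : p ≠ q) :
    cosetWeight d p * cosetWeight d q = 0 := by
  rw [cosetWeight, cosetWeight, diagonal_mul_diagonal, ← diagonal_zero]
  congr 1
  ext (x | x)
  · by_cases hx : (x.1 : G ⧸ H) = p
    · simp [hx, hpq]
    · simp [hx]
  · simp

theorem cosetWeight_sqrt_mul_self {d : Fin k → ℝ} (hd : ∀ i, 0 ≤ d i) (q : G ⧸ H) :
    cosetWeight (fun i => √(d i)) q * cosetWeight (fun i => √(d i)) q = cosetWeight d q := by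
  simp only [cosetWeight, diagonal_mul_diagonal]
  congr 1
  ext (x | x)
  · by_cases hx : (x.1 : G ⧸ H) = q
    · simp only [Sum.elim_inl, hx, if_true]
      rw [← Complex.ofReal_mul, Real.mul_self_sqrt (hd _)]
    · simp [hx]
  · simp

theorem norm_cosetWeight_le {d : Fin k → ℝ} (hd : ∀ i, d i ∈ Set.Icc (0 : ℝ) 1) (q : G ⧸ H) :
    ‖cosetWeight d q‖ ≤ 1 := by
  rw [cosetWeight, l2_opNorm_diagonal, pi_norm_le_iff_of_nonneg zero_le_one]
  rintro (x | x)
  · by_cases hx : (x.1 : G ⧸ H) = q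
    · simpa [hx, abs_of_nonneg (hd x.2).1] using (hd x.2).2
    · simp [hx]
  · simp

theorem fromBlocks_one_mul_cosetWeight (d : Fin k → ℝ) (q : G ⧸ H) :
    fromBlocks 1 0 0 0 * cosetWeight d q = cosetWeight d q := by
  rw [← diagonal_one, ← diagonal_zero, fromBlocks_diagonal, cosetWeight, diagonal_mul_diagonal]
  congr 1
  ext (x | x) <;> simp

/-- All its blocks are built from translation-invariant matrices. This makes the second tower
equivariant. -/
theorem towerIsometry_submatrix (g : G) :
    (towerIsometry G k).submatrix (towerShift k g) (towerShift k g) = towerIsometry G k := by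
  ext (x | x) (y | y)
  · simp [towerIsometry, towerShift, towerCorner, avgProj, one_apply]
  · rfl
  · rfl
  · rfl

theorem norm_towerIsometry_le : ‖towerIsometry G k‖ ≤ 1 := by
  have h : IsStarProjection
      (fromBlocks 1 0 0 0 : Matrix ((G × Fin k) ⊕ Unit) ((G × Fin k) ⊕ Unit) ℂ) := by
    refine ⟨?_, ?_⟩
    · simp [IsIdempotentElem, fromBlocks_multiply]
    · simp [IsSelfAdjoint, star_eq_conjTranspose, fromBlocks_conjTranspose]
  have h2 := h.norm_le
  rw [← towerIsometry_star_mul_self, ← star_eq_conjTranspose, CStarRing.norm_star_mul_self] at h2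
  nlinarith [norm_nonneg (towerIsometry G k)]

theorem norm_fromBlocks_avgProj_le :
    ‖(fromBlocks (avgProj G ⊗ₖ 1) 0 0 0 :
      Matrix ((G × Fin k) ⊕ Unit) ((G × Fin k) ⊕ Unit) ℂ)‖ ≤ 1 := by
  refine IsStarProjection.norm_le _ ⟨?_, ?_⟩
  · simp [IsIdempotentElem, fromBlocks_multiply, ← mul_kronecker_mul, avgProj_mul_self]
  · simp [IsSelfAdjoint, star_eq_conjTranspose, fromBlocks_conjTranspose, conjTranspose_kronecker,
      avgProj_star]

variable (G) in
/-- The identity for the first tower and `towerIsometry` for the second one. -/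
def towerFrame (k : ℕ) : Fin 2 → Matrix ((G × Fin k) ⊕ Unit) ((G × Fin k) ⊕ Unit) ℂ :=
  ![1, towerIsometry G k]

/-- The frame is isometric on `ℓ²(G) ⊗ ℂ^k`, where the coset weights live. Hence conjugation by it
is multiplicative on them and products of tower elements reduce to diagonal matrices. -/
theorem towerFrame_star_mul_self_mul (r : Fin 2) (d : Fin k → ℝ) (q : G ⧸ H) :
    (towerFrame G k r)ᴴ * towerFrame G k r * cosetWeight d q = cosetWeight d q := by
  match r with
  | 0 => simp [towerFrame]
  | 1 =>
    exact (congrArg (· * cosetWeight d q) towerIsometry_star_mul_self).trans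
      (fromBlocks_one_mul_cosetWeight d q)

theorem towerFrame_submatrix (r : Fin 2) (g : G) :
    (towerFrame G k r).submatrix (towerShift k g) (towerShift k g) = towerFrame G k r := by
  match r with
  | 0 => exact submatrix_one_equiv _
  | 1 => exact towerIsometry_submatrix g

theorem norm_towerFrame_le (r : Fin 2) : ‖towerFrame G k r‖ ≤ 1 := by
  match r with
  | 0 => exact IsStarProjection.norm_le _ (IsStarProjection.one _)
  | 1 => exact norm_towerIsometry_le

/-- `r`-th tower of diagonal weight `d`. -/
def tower (r : Fin 2) (d : Fin k → ℝ) (q : G ⧸ H) :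
    Matrix ((G × Fin k) ⊕ Unit) ((G × Fin k) ⊕ Unit) ℂ :=
  towerFrame G k r * cosetWeight d q * (towerFrame G k r)ᴴ

theorem norm_tower_le (r : Fin 2) {d : Fin k → ℝ} (hd : ∀ i, d i ∈ Set.Icc (0 : ℝ) 1)
    (q : G ⧸ H) : ‖tower r d q‖ ≤ 1 := by
  have h1 := norm_towerFrame_le (G := G) (k := k) r
  have h2 := norm_cosetWeight_le hd q
  calc ‖tower r d q‖ ≤ ‖towerFrame G k r‖ * ‖cosetWeight d q‖ * ‖(towerFrame G k r)ᴴ‖ :=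
        (norm_mul_le _ _).trans (by gcongr; exact norm_mul_le _ _)
    _ ≤ 1 * 1 * 1 := by
        rw [← star_eq_conjTranspose, norm_star]
        gcongr
    _ = 1 := by norm_num

theorem tower_mul_tower (r : Fin 2) (d e : Fin k → ℝ) (p q : G ⧸ H) :
    tower r d p * tower r e q =
      towerFrame G k r * (cosetWeight d p * cosetWeight e q) * (towerFrame G k r)ᴴ := by
  calc tower r d p * tower r e q = towerFrame G k r * (cosetWeight d p *
        ((towerFrame G k r)ᴴ * towerFrame G k r * cosetWeight e q)) * (towerFrame G k r)ᴴ := by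
        simp only [tower, Matrix.mul_assoc]
    _ = _ := by rw [towerFrame_star_mul_self_mul]

theorem tower_mul_tower_of_ne (r : Fin 2) (d : Fin k → ℝ) {p q : G ⧸ H} (hpq : p ≠ q) :
    tower r d p * tower r d q = 0 := by
  rw [tower_mul_tower, cosetWeight_mul_cosetWeight d hpq]
  simp

theorem tower_conjTranspose (r : Fin 2) (d : Fin k → ℝ) (q : G ⧸ H) :
    (tower r d q)ᴴ = tower r d q := by
  simp [tower, conjTranspose_mul, cosetWeight_conjTranspose, Matrix.mul_assoc]

/-- Taking square roots of the weights gives an explicit witness of positivity. -/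
theorem tower_sqrt_star_mul_self (r : Fin 2) {d : Fin k → ℝ} (hd : ∀ i, 0 ≤ d i) (q : G ⧸ H) :
    (tower r (fun i => √(d i)) q)ᴴ * tower r (fun i => √(d i)) q = tower r d q := by
  rw [tower_conjTranspose, tower_mul_tower, cosetWeight_sqrt_mul_self hd, tower]

theorem tower_submatrix (r : Fin 2) (d : Fin k → ℝ) (g : G) (q : G ⧸ H) :
    (tower r d q).submatrix (towerShift k g⁻¹) (towerShift k g⁻¹) = tower r d (g • q) := by
  have h : ((towerFrame G k r)ᴴ).submatrix (towerShift k g⁻¹) (towerShift k g⁻¹) =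
      (towerFrame G k r)ᴴ := by
    rw [← conjTranspose_submatrix, towerFrame_submatrix]
  rw [tower, ← submatrix_mul_equiv _ _ _ (towerShift k g⁻¹), h,
    ← submatrix_mul_equiv _ _ _ (towerShift k g⁻¹), towerFrame_submatrix, cosetWeight_submatrix,
    tower]

theorem sum_tower [Fintype (G ⧸ H)] (hk : k ≠ 0) :
    ∑ r, ∑ q : G ⧸ H, tower r (towerWeight k r) q =
      1 - (k : ℂ)⁻¹ • fromBlocks (avgProj G ⊗ₖ 1) 0 0 0 := by
  simp only [tower, ← Finset.sum_mul, ← Finset.mul_sum, sum_cosetWeight, Fin.sum_univ_two]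
  have h := towerIsometry_mul_weight_mul_star (G := G) hk
  simp only [towerFrame, cons_val_zero, cons_val_one, cons_val_fin_one, h]
  simp

end RokhlinTowers

/-! ### Central sequences in the infinite tensor product -/

section Central

variable {I : ℕ → Type*} {b : ∀ n, I n} [∀ n, DecidableEq (I n)] [∀ n, Fintype (I n)]

theorem leg_mul_leg_comm {m n : ℕ} (h : m ≠ n) (M : Matrix (I m) (I m) ℂ)
    (N : Matrix (I n) (I n) ℂ) : leg b m M * leg b n N = leg b n N * leg b m M := by
  ext ξ x
  rw [mul_apply_eq_comp, mul_apply_eq_comp, leg_apply, leg_apply]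
  have h1 : ∀ j, (x.update m j).1 n = x.1 n := fun j => Function.update_of_ne h.symm _ _
  have h2 : ∀ j, (x.update n j).1 m = x.1 m := fun j => Function.update_of_ne h _ _
  have h3 : ∀ i j, (x.update m i).update n j = (x.update n j).update m i := fun i j =>
    Subtype.ext (Function.update_comm h _ _ _)
  simp only [leg_apply, h1, h2, h3, Finset.mul_sum]
  rw [Finset.sum_comm]
  exact Finset.sum_congr rfl fun j _ => Finset.sum_congr rfl fun i _ => mul_left_comm _ _ _

theorem eventually_leg_comm {T : TensorHilbert b →L[ℂ] TensorHilbert b}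
    (hT : T ∈ StarAlgebra.adjoin ℂ (⋃ n, Set.range (leg b n))) :
    ∀ᶠ n in atTop, ∀ M, leg b n M * T = T * leg b n M := by
  induction hT using StarAlgebra.adjoin_induction with
  | mem T hT =>
    obtain ⟨m, N, rfl⟩ := Set.mem_iUnion.1 hT
    filter_upwards [eventually_gt_atTop m] with n hn M
    exact leg_mul_leg_comm hn.ne' M N
  | algebraMap r => exact Eventually.of_forall fun n M => (Algebra.commutes r _).symm
  | add S T _ _ hS hT =>
    filter_upwards [hS, hT] with n hS hT M
    rw [mul_add, add_mul, hS, hT]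
  | mul S T _ _ hS hT =>
    filter_upwards [hS, hT] with n hS hT M
    rw [← mul_assoc, hS, mul_assoc, hT, mul_assoc]
  | star T _ hT =>
    filter_upwards [hT] with n hT M
    have h := congrArg star (hT (star M))
    rw [star_mul, star_mul, map_star, star_star] at h
    exact h.symm

/-- Bounded sequences of elements of the tensor factors are central sequences. -/
theorem tendsto_norm_commutator_leg (M : ∀ n, Matrix (I n) (I n) ℂ)
    (hM : ∀ n, ‖leg b n (M n)‖ ≤ 1) {T : TensorHilbert b →L[ℂ] TensorHilbert b}
    (hT : T ∈ tensorAlgebra b) :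
    Tendsto (fun n => ‖T * leg b n (M n) - leg b n (M n) * T‖) atTop (𝓝 0) := by
  rw [Metric.tendsto_atTop']
  intro ε hε
  obtain ⟨S, hS, hST⟩ := Metric.mem_closure_iff.1
    (show T ∈ closure (StarAlgebra.adjoin ℂ (⋃ n, Set.range (leg b n)) : Set _) from hT)
    (ε / 2) (half_pos hε)
  obtain ⟨N, hN⟩ := eventually_atTop.1 (eventually_leg_comm hS)
  refine ⟨N, fun n hn => ?_⟩
  rw [dist_zero_right, norm_norm]
  -- The approximant `S` involves finitely many factors and commutes with the later ones, so only `T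
  -- - S` contributes.
  have e : T * leg b n (M n) - leg b n (M n) * T =
      (T - S) * leg b n (M n) - leg b n (M n) * (T - S) := by
    rw [sub_mul, mul_sub, hN n hn.le]
    abel
  rw [dist_eq_norm] at hST
  calc ‖T * leg b n (M n) - leg b n (M n) * T‖
      ≤ ‖T - S‖ * ‖leg b n (M n)‖ + ‖leg b n (M n)‖ * ‖T - S‖ := by
        rw [e]
        exact (norm_sub_le _ _).trans (add_le_add (norm_mul_le _ _) (norm_mul_le _ _))
    _ ≤ ‖T - S‖ * 1 + 1 * ‖T - S‖ := by
        gcongr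
        · exact hM n
        · exact hM n
    _ < ε := by linarith

end Central

/-! ### Towers in the factors of the product algebra -/

section FactorTowers

open Matrix
open scoped Kronecker Matrix.Norms.L2Operator

variable {G : Type*} [Group G] [Fintype G]

/-- The orbit decomposition of the basis of `ℓ²(G)^{⊗(n+1)} ⊕ ℂ`: a tuple is determined by its first
entry and the quotients of the other entries by the first one. -/
def factorEquiv (n : ℕ) : FactorIndex G n ≃ (G × Fin (Fintype.card G ^ n)) ⊕ Unit :=
  have σ : (Fin n → G) ≃ Fin (Fintype.card G ^ n) := by
    classical exact Fintype.equivFinOfCardEq (by simp)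
  Equiv.sumCongr
    { toFun := fun t => (t 0, σ fun i => (t 0)⁻¹ * t i.succ)
      invFun := fun x => Fin.cons x.1 fun i => x.1 * σ.symm x.2 i
      left_inv := fun t => by
        ext i
        refine Fin.cases ?_ (fun i => ?_) i <;> simp
      right_inv := fun x => by simp }
    (Equiv.refl Unit)

/-- The quotients by the first entry are invariant under left translation, so only the
`G`-coordinate moves. -/
theorem factorEquiv_factorShift (n : ℕ) (g : G) (i : FactorIndex G n) :
    factorEquiv n (factorShift n g i) = towerShift _ g (factorEquiv n i) := by
  rcases i with t | u
  · simp [factorEquiv, factorShift, towerShift, mul_assoc]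
  · rfl

variable [DecidableEq G]

variable (G) in
/-- The embedding of `B(ℓ²(G) ⊗ ℂ^k ⊕ ℂ)`, where `k = |G|^n`, as the `n`-th factor of the product
algebra. -/
def factorEmb (n : ℕ) : Matrix ((G × Fin (Fintype.card G ^ n)) ⊕ Unit)
    ((G × Fin (Fintype.card G ^ n)) ⊕ Unit) ℂ →⋆ₐ[ℂ] productAlgebra G where
  toFun M := ⟨leg (factorBase G) n (M.submatrix (factorEquiv n) (factorEquiv n)), leg_mem n _⟩
  map_one' := Subtype.ext (by
    change leg _ _ _ = 1
    rw [submatrix_one_equiv, map_one])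
  map_mul' M N := Subtype.ext (by
    change leg _ _ _ = leg _ _ _ * leg _ _ _
    rw [← submatrix_mul_equiv _ _ _ (factorEquiv n), map_mul])
  map_zero' := Subtype.ext (map_zero (leg (factorBase G) n))
  map_add' M N := Subtype.ext (map_add (leg (factorBase G) n) _ _)
  commutes' c := Subtype.ext (by
    change leg _ _ _ = algebraMap ℂ _ c
    rw [Algebra.algebraMap_eq_smul_one, Algebra.algebraMap_eq_smul_one, submatrix_smul,
      Pi.smul_apply, Pi.smul_apply, submatrix_one_equiv, map_smul, map_one])
  map_star' M := Subtype.ext (map_star (leg (factorBase G) n) _)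

theorem norm_factorEmb_le (n : ℕ) (M : Matrix ((G × Fin (Fintype.card G ^ n)) ⊕ Unit)
    ((G × Fin (Fintype.card G ^ n)) ⊕ Unit) ℂ) : ‖factorEmb G n M‖ ≤ ‖M‖ :=
  NonUnitalStarAlgHom.norm_apply_le (factorEmb G n) M

theorem productAction_factorEmb (g : G) (n : ℕ)
    (M : Matrix ((G × Fin (Fintype.card G ^ n)) ⊕ Unit)
      ((G × Fin (Fintype.card G ^ n)) ⊕ Unit) ℂ) :
    productAction G g (factorEmb G n M) =
      factorEmb G n (M.submatrix (towerShift _ g⁻¹) (towerShift _ g⁻¹)) := by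
  refine (productAction_leg g n _).trans (Subtype.ext (congrArg (leg (factorBase G) n) ?_))
  ext i j
  rw [factorUnitary_conj_apply]
  simp only [submatrix_apply, factorEquiv_factorShift]

/-- The sequence with `n`-th entry in the `n`-th factor. -/
def factorSeq (M : ∀ n, Matrix ((G × Fin (Fintype.card G ^ n)) ⊕ Unit)
    ((G × Fin (Fintype.card G ^ n)) ⊕ Unit) ℂ) (hM : ∀ n, ‖M n‖ ≤ 1) : ℕ →ᵇ productAlgebra G :=
  BoundedContinuousFunction.ofNormedAddCommGroupDiscrete (fun n => factorEmb G n (M n)) 1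
    fun n => (norm_factorEmb_le n _).trans (hM n)

theorem sqrt_mem_Icc {x : ℝ} (hx : x ∈ Set.Icc (0 : ℝ) 1) : √x ∈ Set.Icc (0 : ℝ) 1 :=
  ⟨Real.sqrt_nonneg x, Real.sqrt_le_one.2 hx.2⟩

/-- The sequence with `n`-th entry the `r`-th Rokhlin tower in the `n`-th factor. -/
def towerSeq {H : Subgroup G} (r : Fin 2) (q : G ⧸ H) : ℕ →ᵇ productAlgebra G :=
  factorSeq (fun _ => tower r (towerWeight _ r) q) fun _ => norm_tower_le r (towerWeight_mem r) q

/-- The defect in the factor with index `n` is `1 / k` times a projection, with `k = |G|^n`. -/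
theorem norm_sum_towerSeq_sub_one_le {H : Subgroup G} [Fintype (G ⧸ H)] (n : ℕ) :
    ‖(∑ r, ∑ q : G ⧸ H, towerSeq r q - 1) n‖ ≤ ((Fintype.card G : ℝ)⁻¹) ^ n := by
  have h : (∑ r, ∑ q : G ⧸ H, towerSeq r q - 1) n = -factorEmb G n
      (((Fintype.card G ^ n : ℕ) : ℂ)⁻¹ • fromBlocks (avgProj G ⊗ₖ 1) 0 0 0) := by
    have h1 : (∑ r, ∑ q : G ⧸ H, towerSeq r q) n =
        factorEmb G n (∑ r, ∑ q : G ⧸ H, tower r (towerWeight _ r) q) := by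
      simp only [BoundedContinuousFunction.sum_apply, map_sum]
      rfl
    change (∑ r, ∑ q : G ⧸ H, towerSeq r q) n - 1 = _
    rw [h1, sum_tower (pow_ne_zero n Fintype.card_ne_zero), map_sub, map_one]
    abel
  rw [h, norm_neg]
  refine (norm_factorEmb_le n _).trans ((norm_smul_le _ _).trans ?_)
  refine (mul_le_of_le_one_right (norm_nonneg _) norm_fromBlocks_avgProj_le).trans_eq ?_
  simp

/-- The positive square root of `towerSeq`. -/
def sqrtTowerSeq {H : Subgroup G} (r : Fin 2) (q : G ⧸ H) : ℕ →ᵇ productAlgebra G :=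
  factorSeq (fun _ => tower r (fun i => √(towerWeight _ r i)) q)
    fun _ => norm_tower_le r (fun i => sqrt_mem_Icc (towerWeight_mem r i)) q

theorem star_sqrtTowerSeq_mul_self {H : Subgroup G} (r : Fin 2) (q : G ⧸ H) :
    star (sqrtTowerSeq r q) * sqrtTowerSeq r q = towerSeq r q := by
  ext1 n
  change star (factorEmb G n _) * factorEmb G n _ = factorEmb G n _
  rw [← map_star, ← map_mul, star_eq_conjTranspose,
    tower_sqrt_star_mul_self r fun i => (towerWeight_mem r i).1]

theorem norm_towerSeq_apply_le {H : Subgroup G} (r : Fin 2) (q : G ⧸ H) (n : ℕ) :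
    ‖towerSeq r q n‖ ≤ 1 :=
  (norm_factorEmb_le n _).trans (norm_tower_le r (towerWeight_mem r) q)

theorem seqMap_towerSeq {H : Subgroup G} (r : Fin 2) (g : G) (q : G ⧸ H) :
    Ultrapower.seqMap (productAction G g) (towerSeq r q) = towerSeq r (g • q) := by
  ext1 n
  change productAction G g (factorEmb G n _) = factorEmb G n _
  rw [productAction_factorEmb, tower_submatrix]

theorem towerSeq_mul_towerSeq {H : Subgroup G} (r : Fin 2) {p q : G ⧸ H} (hpq : p ≠ q) :
    towerSeq r p * towerSeq r q = 0 := by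
  ext1 n
  change factorEmb G n _ * factorEmb G n _ = 0
  rw [← map_mul, tower_mul_tower_of_ne r _ hpq, map_zero]

/-- The entries move to ever later tensor factors, so commutators tend to zero along `atTop`, hence
along a free ultrafilter. -/
theorem const_mul_towerSeq_sub_mem {H : Subgroup G} (r : Fin 2) (q : G ⧸ H)
    (ω : Ultrafilter ℕ) (hω : (ω : Filter ℕ) ≤ cofinite) (a : productAlgebra G) :
    BoundedContinuousFunction.const ℕ a * towerSeq r q -
      towerSeq r q * BoundedContinuousFunction.const ℕ a ∈ nullIdeal ω (productAlgebra G) := by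
  rw [Nat.cofinite_eq_atTop] at hω
  exact mem_nullIdeal.2
    ((tendsto_norm_commutator_leg _ (norm_towerSeq_apply_le r q) a.2).mono_left hω)

theorem sum_towerSeq_sub_one_mem [Nontrivial G] {H : Subgroup G} [Fintype (G ⧸ H)]
    (ω : Ultrafilter ℕ) (hω : (ω : Filter ℕ) ≤ cofinite) :
    ∑ r, ∑ q : G ⧸ H, towerSeq r q - 1 ∈ nullIdeal ω (productAlgebra G) := by
  rw [Nat.cofinite_eq_atTop] at hω
  refine mem_nullIdeal.2 (squeeze_zero (fun n => norm_nonneg _) norm_sum_towerSeq_sub_one_le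
    ((tendsto_pow_atTop_nhds_zero_of_lt_one (by positivity) ?_).mono_left hω))
  -- Nontriviality of `G` makes the ratio `1 / |G|` less than one.
  exact inv_lt_one_of_one_lt₀ (by exact_mod_cast Fintype.one_lt_card)

theorem dimRokLE_one [Nontrivial G] (ω : Ultrafilter ℕ) (hω : (ω : Filter ℕ) ≤ cofinite) :
    DimRokLE ω (productAction G) 1 := by
  intro H _ _
  refine ⟨fun r q => Ideal.Quotient.mk (nullIdeal ω _) (towerSeq r q), fun r q => ⟨?_, ?_⟩,
    fun r q a => ?_, fun r g q => ?_, fun r p q hpq => ?_, ?_⟩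
  · exact ⟨Ideal.Quotient.mk (nullIdeal ω _) (sqrtTowerSeq r q),
      congrArg (Ideal.Quotient.mk (nullIdeal ω _)) (star_sqrtTowerSeq_mul_self r q).symm⟩
  · exact (Submodule.Quotient.norm_mk_le _ _).trans
      ((BoundedContinuousFunction.norm_le zero_le_one).2 (norm_towerSeq_apply_le r q))
  · exact Ideal.Quotient.eq.2 (const_mul_towerSeq_sub_mem r q ω hω a)
  · exact congrArg (Ideal.Quotient.mk (nullIdeal ω _)) (seqMap_towerSeq r g q)
  · exact congrArg (Ideal.Quotient.mk (nullIdeal ω _)) (towerSeq_mul_towerSeq r hpq)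
  · have := Fintype.ofFinite (G ⧸ H)
    simp only [finsum_eq_sum_of_fintype, ← map_sum]
    exact Ideal.Quotient.eq.2 (sum_towerSeq_sub_one_mem ω hω)

end FactorTowers

end

theorem mainTheorem9 (G : Type*) [Group G] [Fintype G] [DecidableEq G] [Nontrivial G]
    (ω : Ultrafilter ℕ) (hω : (ω : Filter ℕ) ≤ Filter.cofinite) :
    dimRok ω (productAction G) = 1 := by
  refine le_antisymm (iInf₂_le 1 (dimRokLE_one ω hω)) (le_iInf₂ fun d hd => ?_)
  have h : d ≠ 0 := by
    rintro rfl
    exact not_dimRokLE_zero ω hd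
  exact_mod_cast Nat.one_le_iff_ne_zero.2 h
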